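/- Consider an ad hoc network in the plane. The transmitters $T_0,T_1,\dots$ form a homogeneous Poisson point process of density $\lambda>0$. The receiver of $T_m$ is at distance $d>0$ from $T_m$; the orientations have a common arbitrary law. The path-loss exponent is $\alpha>2$. The fading coefficients $h_{ms}$ from $T_s$ to the receiver of $T_m$ are i.i.d. Rayleigh (of any scale). Time is slotted, and each transmitter has a battery of infinite capacity. In each slot it receives one unit of energy with probability $p\in(0,1]$ and none otherwise. If $T_m$ uses the access probability $q_m\in[0,1]$ and its battery energy satisfies $E_m(t)\ge 1$, then with probability $q_m$ it transmits in slot $t$, which costs one unit of energy; thus $E_m(t+1)=E_m(t)+A_m(t)-\mathbf 1\{E_m(t)\ge1\}\chi_m(t)$ with $A_m(t)\sim\mathrm{Bernoulli}(p)$ and $\chi_m(t)\sim\mathrm{Bernoulli}(q_m)$. The variables $A_m(t),\chi_m(t)$ and the initial energies $E_m(0)$ are all independent, and the $E_m(0)$ have a common arbitrary law on $\{0,1,2,\dots\}$. Locations, orientations, fading and energy/access variables are independent of each other. Let $d_{ns}$ be the distance from $T_s$ to the receiver of $T_n$ and $$\mathsf{SIR}_n(t)=\frac{d^{-\alpha}|h_{nn}|^2}{\sum_{s\ne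 n}\mathbf 1\{T_s\text{ transmits at }t\}\,d_{ns}^{-\alpha}|h_{ns}|^2}.$$ Fix a threshold $\theta>0$ and a rate $R>0$ (for instance $R=1$ or $R=\log(1+\theta)$). If a typical transmitter $T_n$ uses $q$ and all others use $\tilde q$, its throughput is $$\mathsf{TH}(q,\tilde q)=r\,q\,\mathbb P(\mathsf{SIR}_n>\theta)\,R,\qquad r=\mathbb P(E_n\ge1),$$ where both probabilities are the limits as $t\to\infty$ of the probabilities at time $t$ for a typical transmitter; that is, the expected number of transmitters $T_n$ in a Borel window $A$ of positive finite area that have the property when they use $q$ and all others use $\tilde q$, divided by the expected number of transmitters in $A$. A $q^*\in[0,1]$ is a symmetric Nash equilibrium (SNE) if $\mathsf{TH}(q^*,q^*)=\max_{q\in[0,1]}\mathsf{TH}(q,q^*)$, and the transmission capacity is then $C=\lambda\,\mathsf{TH}(q^*,q^*)$. Put $$\lambda_{max}=\frac1{d^2\theta^{2/\alpha}\kappa(\alpha)},\qquad \kappa(\alpha)=\frac{2\pi^2}{\alpha\sin(2\pi/\alpha)}.$$ Then, for every window $A$, the limits defining $\mathsf{TH}(q,\tilde q)$ exist for all $q,\tilde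 q\in[0,1]$; every $q^*$ with $p\le q^*\le1$ is an SNE; and at any SNE $q^*$ $$\mathsf{TH}(q^*,q^*)=p\,\exp\left(-\frac{p\lambda}{\lambda_{max}}\right)R,\qquad C=\lambda p\,\exp\left(-\frac{p\lambda}{\lambda_{max}}\right)R.$$ In particular, for $R=1$ these are $p\exp(-p\lambda/\lambda_{max})$ and $\lambda p\exp(-p\lambda/\lambda_{max})$. -/

import Mathlib

open MeasureTheory ProbabilityTheory Filter Topology
open scoped ENNReal NNReal

/-- The plane with its Euclidean distance and Lebesgue measure. -/
abbrev Plane : Type := EuclideanSpace ℝ (Fin 2)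

/-- The number of indices `m` with `X m ω ∈ B`, i.e. the number of points in `B`. -/
noncomputable def pointCount {Ω : Type*} (X : ℕ → Ω → Plane) (B : Set Plane) (ω : Ω) : ℕ∞ :=
  {m : ℕ | X m ω ∈ B}.encard

/-- The random points `X 0, X 1, …` enumerate a homogeneous Poisson point process of density `lam`
on the plane: the number of points in a Borel set of finite area is Poisson with mean `lam` times
the area, and the numbers of points in disjoint such sets are independent. -/
structure IsPoissonPointProcess {Ω : Type*} [MeasurableSpace Ω] (P : Measure Ω) (lam : ℝ)
    (X : ℕ → Ω → Plane) : Prop where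
  measurable : ∀ m, Measurable (X m)
  count_law : ∀ B : Set Plane, MeasurableSet B → volume B < ∞ → ∀ k : ℕ,
    P {ω | pointCount X B ω = k} = poissonMeasure (Real.toNNReal (lam * (volume B).toReal)) {k}
  count_indep : ∀ (k : ℕ) (B : Fin k → Set Plane), (∀ i, MeasurableSet (B i)) →
    (∀ i, volume (B i) < ∞) → Pairwise (fun i j => Disjoint (B i) (B j)) →
    iIndepFun (fun i => pointCount X (B i)) P

/-- The Rayleigh distribution with scale `σ`. -/
noncomputable def rayleighMeasure (σ : ℝ) : Measure ℝ :=
  volume.withDensity fun x =>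
    ENNReal.ofReal (if 0 ≤ x then x / σ ^ 2 * Real.exp (-x ^ 2 / (2 * σ ^ 2)) else 0)

/-- The σ-algebra generated by a family of random variables. -/
abbrev generated {Ω ι E : Type*} [mE : MeasurableSpace E] (X : ι → Ω → E) : MeasurableSpace Ω :=
  ⨆ i, mE.comap (X i)

/-- The randomness of an energy harvesting ad hoc network with transmitter density `lam`, energy
arrival rate `p` and Rayleigh fading of scale `σ`. -/
structure HarvestingNetwork {Ω : Type*} [MeasurableSpace Ω] (P : Measure Ω) (lam p σ : ℝ) where
  /-- Location of the transmitter `m`. -/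
  loc : ℕ → Ω → Plane
  /-- Unit vector pointing from the transmitter `m` to its receiver. -/
  dir : ℕ → Ω → Metric.sphere (0 : Plane) 1
  /-- `fade m s` is the fading coefficient from the transmitter `s` to the receiver `m`. -/
  fade : ℕ → ℕ → Ω → ℂ
  /-- Energy in the battery of the transmitter `m` at time `0`. -/
  init : ℕ → Ω → ℕ
  /-- `arrival m t` is the energy that arrives at the transmitter `m` in the slot `t`. -/
  arrival : ℕ → ℕ → Ω → ℕ
  /-- `coin m t` is uniform on `[0, 1]`; with access probability `q` the transmitter `m`, if it has
  energy, transmits in the slot `t` when `coin m t < q`, an event of probability `q`. -/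
  coin : ℕ → ℕ → Ω → ℝ
  loc_poisson : IsPoissonPointProcess P lam loc
  dir_measurable : ∀ m, Measurable (dir m)
  /-- The orientations have one and the same law, which is arbitrary. -/
  dir_law : ∀ m, IdentDistrib (dir m) (dir 0) P P
  fade_measurable : ∀ m s, Measurable (fade m s)
  fade_law : ∀ m s, P.map (fun ω => ‖fade m s ω‖) = rayleighMeasure σ
  fade_indep : iIndepFun (fun i : ℕ × ℕ => fade i.1 i.2) P
  init_measurable : ∀ m, Measurable (init m)
  /-- The initial energies are i.i.d. with an arbitrary law on `ℕ`. -/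
  init_law : ∀ m, IdentDistrib (init m) (init 0) P P
  init_indep : iIndepFun init P
  arrival_measurable : ∀ m t, Measurable (arrival m t)
  arrival_one : ∀ m t, P {ω | arrival m t ω = 1} = ENNReal.ofReal p
  arrival_zero : ∀ m t, P {ω | arrival m t ω = 0} = ENNReal.ofReal (1 - p)
  arrival_indep : iIndepFun (fun i : ℕ × ℕ => arrival i.1 i.2) P
  coin_measurable : ∀ m t, Measurable (coin m t)
  coin_law : ∀ m t, P.map (coin m t) = volume.restrict (Set.Icc (0 : ℝ) 1)
  coin_indep : iIndepFun (fun i : ℕ × ℕ => coin i.1 i.2) P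
  /-- Locations, orientations, fading, initial energies, arrivals and coins are independent. -/
  indep : iIndep
    (![generated loc, generated dir, generated (fun i : ℕ × ℕ => fade i.1 i.2), generated init,
      generated (fun i : ℕ × ℕ => arrival i.1 i.2), generated (fun i : ℕ × ℕ => coin i.1 i.2)]
      : Fin 6 → MeasurableSpace Ω) P

namespace HarvestingNetwork

variable {Ω : Type*} [MeasurableSpace Ω] {P : Measure Ω} {lam p σ : ℝ}

/-- Energy of the transmitter `m` at time `t` when it uses the access probability `q` and a battery
of infinite capacity: `E (t + 1) = E t + A t - 1{E t ≥ 1} χ t`. -/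
noncomputable def energy (N : HarvestingNetwork P lam p σ) (q : ℝ) (m : ℕ) : ℕ → Ω → ℕ
  | 0, ω => N.init m ω
  | t + 1, ω => N.energy q m t ω + N.arrival m t ω -
      (if 1 ≤ N.energy q m t ω ∧ N.coin m t ω < q then 1 else 0)

/-- The transmitter `m`, using the access probability `q`, transmits at time `t`. -/
def Transmits (N : HarvestingNetwork P lam p σ) (q : ℝ) (m t : ℕ) (ω : Ω) : Prop :=
  1 ≤ N.energy q m t ω ∧ N.coin m t ω < q

/-- Location of the receiver of the transmitter `n`, at distance `d` from it. -/
noncomputable def receiver (N : HarvestingNetwork P lam p σ) (d : ℝ) (n : ℕ) (ω : Ω) : Plane :=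
  N.loc n ω + d • (N.dir n ω : Plane)

open Classical in
/-- Interference power at the receiver `n` at time `t`, if each transmitter `s` uses the access
probability `prof s` and `α` is the path-loss exponent. -/
noncomputable def interference (N : HarvestingNetwork P lam p σ) (d α : ℝ) (prof : ℕ → ℝ)
    (n t : ℕ) (ω : Ω) : ℝ≥0∞ :=
  ∑' s : ℕ, if s ≠ n ∧ N.Transmits (prof s) s t ω then
    edist (N.loc s ω) (N.receiver d n ω) ^ (-α) * ‖N.fade n s ω‖ₑ ^ 2 else 0

/-- Signal-to-interference ratio between the transmitter `n` and its receiver at time `t`; it is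
infinite when there is no interference. -/
noncomputable def sir (N : HarvestingNetwork P lam p σ) (d α : ℝ) (prof : ℕ → ℝ)
    (n t : ℕ) (ω : Ω) : ℝ≥0∞ :=
  ENNReal.ofReal (d ^ (-α)) * ‖N.fade n n ω‖ₑ ^ 2 / N.interference d α prof n t ω

/-- Probability that the typical transmitter in the window `A` has a property (Palm probability):
the expected number of the transmitters in `A` that have it, divided by the expected number of
transmitters in `A`. `S n` is the event that the transmitter `n` has the property. -/
noncomputable def typicalProb (N : HarvestingNetwork P lam p σ) (A : Set Plane)
    (S : ℕ → Set Ω) : ℝ :=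
  ((∑' n : ℕ, P ({ω | N.loc n ω ∈ A} ∩ S n)) / ∑' n : ℕ, P {ω | N.loc n ω ∈ A}).toReal

/-- Probability that a typical transmitter with access probability `q` has energy at time `t`. -/
noncomputable def energyProbAt (N : HarvestingNetwork P lam p σ) (A : Set Plane) (q : ℝ)
    (t : ℕ) : ℝ :=
  N.typicalProb A fun n => {ω | 1 ≤ N.energy q n t ω}

/-- Probability that `SIR > θ` at time `t` for a typical transmitter that uses the access
probability `q` while all the others use `q'`. -/
noncomputable def successProbAt (N : HarvestingNetwork P lam p σ) (A : Set Plane)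
    (d α θ q q' : ℝ) (t : ℕ) : ℝ :=
  N.typicalProb A fun n =>
    {ω | ENNReal.ofReal θ < N.sir d α (Function.update (fun _ => q') n q) n t ω}

/-- Steady-state probability of having energy. -/
noncomputable def energyProb (N : HarvestingNetwork P lam p σ) (A : Set Plane) (q : ℝ) : ℝ :=
  limUnder atTop (N.energyProbAt A q)

/-- Steady-state success probability. -/
noncomputable def successProb (N : HarvestingNetwork P lam p σ) (A : Set Plane)
    (d α θ q q' : ℝ) : ℝ :=
  limUnder atTop (N.successProbAt A d α θ q q')

/-- Throughput of a typical transmitter that uses the access probability `q` while all the others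
use `q'`; `R` is the rate of a successful transmission. -/
noncomputable def throughput (N : HarvestingNetwork P lam p σ) (A : Set Plane)
    (d α θ R q q' : ℝ) : ℝ :=
  N.energyProb A q * q * N.successProb A d α θ q q' * R

/-- `qs` is a symmetric Nash equilibrium: if all the others use `qs`, no access probability in
`[0, 1]` gives a transmitter a larger throughput than `qs`. -/
def IsSNE (N : HarvestingNetwork P lam p σ) (A : Set Plane) (d α θ R qs : ℝ) : Prop :=
  qs ∈ Set.Icc (0 : ℝ) 1 ∧
    ∀ q ∈ Set.Icc (0 : ℝ) 1, N.throughput A d α θ R q qs ≤ N.throughput A d α θ R qs qs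

/-- Transmission capacity, the throughput of all nodes per unit area, if all use `qs`. -/
noncomputable def capacity (N : HarvestingNetwork P lam p σ) (A : Set Plane)
    (d α θ R qs : ℝ) : ℝ :=
  lam * N.throughput A d α θ R qs qs

end HarvestingNetwork

/-- `κ(α) = 2π² / (α sin (2π/α))`. -/
noncomputable def pathLossConst (α : ℝ) : ℝ :=
  2 * Real.pi ^ 2 / (α * Real.sin (2 * Real.pi / α))

/-- `λ_max = 1 / (d² θ^(2/α) κ(α))`. -/
noncomputable def lamMax (d α θ : ℝ) : ℝ :=
  1 / (d ^ 2 * θ ^ (2 / α) * pathLossConst α)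

/-! The throughput splits into a factor that depends only on the transmitter's own access
probability and one that depends only on the others' (`throughput_eq`): it is `min q p * exp (-(min
q' p * lam / lamMax)) * R`. The game is then transparent. Whatever the others do, the best replies
are the `q ≥ p`, so the equilibria are the points of `[p, 1]`, and there both minima equal `p`.

The first factor comes from the battery, a walk on `ℕ` whose drift away from `0` is `p - q`. Energy
cannot be spent faster than it arrives, so the probability of being nonempty tends to `1` if `q ≤ p`
and to `p / q` otherwise. No stationary law is needed: from the empty battery all tail probabilities
increase in time, their limits satisfy balance equations across each level, and these together with
the mean energy determine the limit (`tendsto_start_zero`). A comparison of mean energies extends it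
to every initial energy (`tendsto_nonempty`).

The second factor is computed at a fixed time `t`. The signal power is exponential, so given
everything else the success probability is `exp` of minus a multiple of the interference
(`measure_inter_success`). The marks of the interferers are independent of each other and of the
geometry; averaging them leaves a product of `harmlessProb` over the other transmitters
(`lintegral_mul_negExp_tsum_mark`). The Mecke formula and the Laplace functional of the Poisson
process (`lintegral_tsum_negExp`) turn this into `exp (-lam ∫ (1 - harmlessProb))`, and the integral
is `transmitProb / lamMax` by `lintegral_plane_path_loss`. This is exact for every `t`; only
`transmitProb` varies with time.

The Poisson process is given through its counts alone. The Mecke formula is therefore proved first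
for weights constant on the cells of a finite partition, where it reduces to generating functions of
Poisson variables, and then for continuous weights by refining the partition. -/

/-! ### Exponential and logarithm on `[0, ∞]` -/

/-- `exp (-x)` for `x` in `[0, ∞]`, with `exp (-∞) = 0`. -/
noncomputable def negExp (x : ℝ≥0∞) : ℝ≥0∞ := EReal.exp (-(x : EReal))

@[simp] lemma negExp_zero : negExp 0 = 1 := by
  simp [negExp]

@[simp] lemma negExp_top : negExp ∞ = 0 := by
  simp [negExp]

lemma negExp_add (x y : ℝ≥0∞) : negExp (x + y) = negExp x * negExp y := by
  rw [negExp, EReal.coe_ennreal_add, EReal.neg_add (Or.inl (by simp)) (Or.inr (by simp)), sub_eq_add_neg, EReal.exp_add]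
  rfl

lemma negExp_le_one (x : ℝ≥0∞) : negExp x ≤ 1 := by
  simp [negExp, EReal.coe_ennreal_nonneg]

lemma negExp_ne_top (x : ℝ≥0∞) : negExp x ≠ ∞ := ((negExp_le_one x).trans_lt ENNReal.one_lt_top).ne

lemma negExp_antitone : Antitone negExp := fun x y h => by
  simpa [negExp] using h

lemma continuous_negExp : Continuous negExp := by
  unfold negExp
  exact ENNReal.continuous_exp.comp (continuous_neg.comp continuous_coe_ennreal_ereal)

lemma measurable_negExp : Measurable negExp := continuous_negExp.measurable

lemma negExp_ofReal {x : ℝ} (hx : 0 ≤ x) : negExp (ENNReal.ofReal x) = ENNReal.ofReal (Real.exp (-x)) := by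
  rw [negExp, EReal.coe_ennreal_ofReal, max_eq_left hx, ← EReal.coe_neg, EReal.exp_coe]

lemma negExp_sum {ι : Type*} (s : Finset ι) (f : ι → ℝ≥0∞) :
    negExp (∑ i ∈ s, f i) = ∏ i ∈ s, negExp (f i) := by
  classical
  induction s using Finset.induction_on with
  | empty => simp
  | insert a s ha ih => rw [Finset.sum_insert ha, Finset.prod_insert ha, negExp_add, ih]

lemma negExp_nat_mul (k : ℕ) (x : ℝ≥0∞) : negExp (k * x) = negExp x ^ k := by
  simpa using negExp_sum (Finset.range k) fun _ => x

/-- `-log v` for `v` in `[0, 1]`. -/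
noncomputable def negLog (v : ℝ≥0∞) : ℝ≥0∞ := (-ENNReal.log v).toENNReal

lemma continuous_negLog : Continuous negLog :=
  (continuous_neg.comp ENNReal.continuous_log).ereal_toENNReal

/-- For `v > 1` the number `-log v` is negative and `toENNReal` truncates it to `0`, hence the
hypothesis. -/
lemma negExp_negLog {v : ℝ≥0∞} (hv : v ≤ 1) : negExp (negLog v) = v := by
  rw [negExp, negLog, EReal.coe_toENNReal, neg_neg, ENNReal.exp_log]
  simpa using hv

/-- Infinite products over the interferers appear only as limits of these partial products.
Divergence of the sum is harmless because `negExp ∞ = 0`. -/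
lemma negExp_tsum (f : ℕ → ℝ≥0∞) :
    Tendsto (fun N => ∏ s ∈ Finset.range N, negExp (f s)) atTop (𝓝 (negExp (∑' s, f s))) := by
  simp_rw [← negExp_sum]
  exact (continuous_negExp.tendsto _).comp ENNReal.summable.hasSum.tendsto_sum_nat

/-! ### The battery as a Markov chain -/

/-- Transition operator of the battery energy with arrival probability `p` and access probability
`q`. -/
noncomputable def batteryStep (p q : ℝ) (f : ℕ → ℝ) (e : ℕ) : ℝ :=
  if e = 0 then (1 - p) * f 0 + p * f 1
  else (1 - p) * q * f (e - 1) + ((1 - p) * (1 - q) + p * q) * f e + p * (1 - q) * f (e + 1)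

namespace batteryStep

variable {p q : ℝ}

/-- `batteryStep p q f e` is the mean of `f` one slot after energy `e`: its weights are nonnegative
and, by `const`, sum to `1`. -/
lemma mono_fun (hp : 0 ≤ p) (hp1 : p ≤ 1) (hq : 0 ≤ q) (hq1 : q ≤ 1) {f g : ℕ → ℝ}
    (h : ∀ e, f e ≤ g e) (e : ℕ) : batteryStep p q f e ≤ batteryStep p q g e := by
  have hp' : 0 ≤ 1 - p := by linarith
  have hq' : 0 ≤ 1 - q := by linarith
  unfold batteryStep
  split_ifs
  · gcongr <;> apply h
  · gcongr <;> apply h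

lemma const (c : ℝ) : batteryStep p q (fun _ => c) = fun _ => c := by
  funext e
  unfold batteryStep
  split_ifs <;> ring

/-- Two batteries with the same arrivals and coins keep their order: the fuller one spends more only
when the other is empty, and then only one unit. -/
lemma monotone (hp : 0 ≤ p) (hp1 : p ≤ 1) (hq : 0 ≤ q) (hq1 : q ≤ 1) {f : ℕ → ℝ}
    (h : Monotone f) : Monotone (batteryStep p q f) := by
  have hp' : 0 ≤ 1 - p := by linarith
  have hq' : 0 ≤ 1 - q := by linarith
  refine monotone_nat_of_le_succ fun e => ?_
  rcases Nat.eq_zero_or_pos e with rfl | he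
  · have h1 := h (Nat.le_succ 0)
    have h2 := h (Nat.le_succ 1)
    simp only [batteryStep, if_true, Nat.succ_ne_zero, if_false, zero_add, Nat.sub_self]
    simp only [Nat.succ_eq_add_one, zero_add] at h1 h2
    -- The difference of the two sides is `(1-p)(1-q)(f 1 - f 0) + p(1-q)(f 2 - f 1)`.
    nlinarith [mul_nonneg (mul_nonneg hp' hq') (sub_nonneg.2 h1),
      mul_nonneg (mul_nonneg hp hq') (sub_nonneg.2 h2)]
  · simp only [batteryStep, he.ne', Nat.succ_ne_zero, if_false]
    have h0 : f (e - 1) ≤ f (e + 1 - 1) := h (by lia)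
    have h1 : f e ≤ f (e + 1) := h (by lia)
    have h2 : f (e + 1) ≤ f (e + 1 + 1) := h (by lia)
    gcongr

/-- The law of the energy started from the empty battery increases in time. -/
lemma le_succ_zero (hp : 0 ≤ p) {f : ℕ → ℝ}
    (h : Monotone f) : f 0 ≤ batteryStep p q f 0 := by
  have := h (Nat.le_succ 0)
  simp only [batteryStep, if_true, Nat.succ_eq_add_one, zero_add] at *
  nlinarith

lemma iterate_monotone (hp : 0 ≤ p) (hp1 : p ≤ 1) (hq : 0 ≤ q) (hq1 : q ≤ 1) {f : ℕ → ℝ}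
    (h : Monotone f) (t : ℕ) : Monotone ((batteryStep p q)^[t] f) := by
  induction t with
  | zero => simpa
  | succ t ih => rw [Function.iterate_succ_apply']; exact monotone hp hp1 hq hq1 ih

lemma iterate_mono_fun (hp : 0 ≤ p) (hp1 : p ≤ 1) (hq : 0 ≤ q) (hq1 : q ≤ 1) {f g : ℕ → ℝ}
    (h : ∀ e, f e ≤ g e) (t e : ℕ) :
    (batteryStep p q)^[t] f e ≤ (batteryStep p q)^[t] g e := by
  induction t generalizing e with
  | zero => exact h e
  | succ t ih => simp_rw [Function.iterate_succ_apply']; exact mono_fun hp hp1 hq hq1 ih e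

lemma iterate_const (c : ℝ) (t : ℕ) :
    (batteryStep p q)^[t] (fun _ => c) = fun _ => c :=
  Function.iterate_fixed (const c) t

lemma iterate_nonneg (hp : 0 ≤ p) (hp1 : p ≤ 1) (hq : 0 ≤ q) (hq1 : q ≤ 1) {f : ℕ → ℝ}
    (h : ∀ e, 0 ≤ f e) (t e : ℕ) : 0 ≤ (batteryStep p q)^[t] f e := by
  simpa [iterate_const] using iterate_mono_fun hp hp1 hq hq1 h t e

lemma iterate_le_one (hp : 0 ≤ p) (hp1 : p ≤ 1) (hq : 0 ≤ q) (hq1 : q ≤ 1) {f : ℕ → ℝ}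
    (h : ∀ e, f e ≤ 1) (t e : ℕ) : (batteryStep p q)^[t] f e ≤ 1 := by
  simpa [iterate_const] using iterate_mono_fun hp hp1 hq hq1 h t e

/-- The battery transition operator as a linear map. -/
noncomputable def linear (p q : ℝ) : (ℕ → ℝ) →ₗ[ℝ] (ℕ → ℝ) where
  toFun := batteryStep p q
  map_add' f g := by
    funext e
    simp only [batteryStep, Pi.add_apply]
    split_ifs <;> ring
  map_smul' c f := by
    funext e
    simp only [batteryStep, Pi.smul_apply, smul_eq_mul, RingHom.id_apply]
    split_ifs <;> ring

lemma iterate_eq_linear (f : ℕ → ℝ) (t : ℕ) :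
    (batteryStep p q)^[t] f = (linear p q ^ t) f := by
  rw [Module.End.pow_apply]; rfl

/-- Indicator of energy at least `k`. -/
def atLeast (k e : ℕ) : ℝ := if k ≤ e then 1 else 0

lemma atLeast_monotone (k : ℕ) : Monotone (atLeast k) := fun a b h => by
  unfold atLeast
  split_ifs <;> first | lia | norm_num

lemma atLeast_nonneg (k e : ℕ) : 0 ≤ atLeast k e := by unfold atLeast; split_ifs <;> norm_num

lemma atLeast_le_one (k e : ℕ) : atLeast k e ≤ 1 := by unfold atLeast; split_ifs <;> norm_num

lemma atLeast_zero : atLeast 0 = fun _ => 1 := by funext e; simp [atLeast]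

lemma atLeast_succ_le (k e : ℕ) : atLeast (k + 1) e ≤ atLeast k e := by
  unfold atLeast
  split_ifs <;> first | lia | norm_num

/-- Balance across the cut between `0` and `1`. An upward crossing needs only an arrival, as an
empty battery never transmits; a downward one needs a transmission without arrival. At the higher
cuts an upward crossing also needs that the battery does not transmit, whence the factor `1 - q` in
`linear_atLeast`. -/
lemma linear_atLeast_one : linear p q (atLeast 1) =
    atLeast 1 + (p • (atLeast 0 - atLeast 1) - (q * (1 - p)) • (atLeast 1 - atLeast 2)) := by
  funext e
  rcases e with _ | _ | e <;> simp [linear, batteryStep, atLeast] <;> ring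

lemma linear_atLeast (k : ℕ) : linear p q (atLeast (k + 2)) = atLeast (k + 2) +
    ((p * (1 - q)) • (atLeast (k + 1) - atLeast (k + 2)) -
      (q * (1 - p)) • (atLeast (k + 2) - atLeast (k + 3))) := by
  funext e
  rcases e with _ | e
  · simp [linear, batteryStep, atLeast]
  · simp only [linear, batteryStep, atLeast, LinearMap.coe_mk, AddHom.coe_mk, Pi.add_apply,
      Pi.sub_apply, Pi.smul_apply, smul_eq_mul, Nat.succ_ne_zero, if_false, Nat.add_sub_cancel]
    split_ifs <;> first | lia | ring

/-- The mean drift: `p` from arrivals, minus `q` while the battery is nonempty. -/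
lemma linear_id : linear p q (fun e : ℕ => (e : ℝ)) =
    (fun e : ℕ => (e : ℝ)) + (p • (fun _ => (1 : ℝ)) - q • atLeast 1) := by
  funext e
  rcases e with _ | e
  · simp [linear, batteryStep, atLeast]
  · simp [linear, batteryStep, atLeast]; ring

lemma linear_pow_id (t e : ℕ) : (linear p q ^ t) (fun e : ℕ => (e : ℝ)) e =
    e + ∑ s ∈ Finset.range t, (p - q * (linear p q ^ s) (atLeast 1) e) := by
  induction t with
  | zero => simp
  | succ t ih =>
    have h1 : (linear p q ^ t) (fun _ => (1 : ℝ)) = fun _ => 1 := by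
      rw [← iterate_eq_linear, iterate_const]
    rw [pow_succ, Module.End.mul_apply, linear_id, map_add, map_sub, map_smul, map_smul, h1,
      Finset.sum_range_succ, ← add_assoc, ← ih]
    simp


/-- From the empty battery the first step can only go up, so by stochastic monotonicity every tail
probability increases in time. -/
lemma tendsto_atLeast (hp : 0 ≤ p) (hp1 : p ≤ 1) (hq : 0 ≤ q) (hq1 : q ≤ 1) (k : ℕ) :
    Tendsto (fun t => (linear p q ^ t) (atLeast k) 0) atTop
      (𝓝 (⨆ t, (linear p q ^ t) (atLeast k) 0)) := by
  refine tendsto_atTop_ciSup (monotone_nat_of_le_succ fun t => ?_) ⟨1, ?_⟩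
  · simp_rw [← iterate_eq_linear, Function.iterate_succ_apply']
    exact le_succ_zero hp (iterate_monotone hp hp1 hq hq1 (atLeast_monotone k) t)
  · rintro _ ⟨t, rfl⟩
    simp only [← iterate_eq_linear]
    exact iterate_le_one hp hp1 hq hq1 (atLeast_le_one k) t 0

/-- The probability that a battery that was empty at time `0` is nonempty. -/
lemma tendsto_start_zero (hp : 0 < p) (hp1 : p ≤ 1) (hq : 0 ≤ q) (hq1 : q ≤ 1) :
    Tendsto (fun t => (linear p q ^ t) (atLeast 1) 0) atTop
      (𝓝 (if q ≤ p then 1 else p / q)) := by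
  have hp' : 0 ≤ 1 - p := by linarith
  have hq' : 0 ≤ 1 - q := by linarith
  obtain ⟨g, ht⟩ : ∃ g : ℕ → ℝ,
      ∀ k, Tendsto (fun t => (linear p q ^ t) (atLeast k) 0) atTop (𝓝 (g k)) :=
    ⟨_, tendsto_atLeast hp.le hp1 hq hq1⟩
  have hg0 : g 0 = 1 := by
    refine tendsto_nhds_unique (ht 0) ?_
    simp_rw [atLeast_zero, ← iterate_eq_linear, iterate_const]
    exact tendsto_const_nhds
  have hanti : ∀ k, g (k + 1) ≤ g k := fun k =>
    le_of_tendsto_of_tendsto' (ht (k + 1)) (ht k) fun t => by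
      simp_rw [← iterate_eq_linear]
      exact iterate_mono_fun hp.le hp1 hq hq1 (atLeast_succ_le k) t 0
  have hnn : ∀ k, 0 ≤ g k := fun k => ge_of_tendsto' (ht k) fun t => by
      simp_rw [← iterate_eq_linear]
      exact iterate_nonneg hp.le hp1 hq hq1 (atLeast_nonneg k) t 0
  -- In the limit the flows up and down through each cut are equal; `g k` is the limit probability
  -- of energy at least `k`.
  have b1 : p * (g 0 - g 1) = q * (1 - p) * (g 1 - g 2) := by
    have h := (ht 1).comp (tendsto_add_atTop_nat 1)
    have h' := (ht 1).add ((((ht 0).sub (ht 1)).const_mul p).sub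
      (((ht 1).sub (ht 2)).const_mul (q * (1 - p))))
    have e := tendsto_nhds_unique h (h'.congr fun t => by
      simp only [Function.comp, pow_succ, Module.End.mul_apply, linear_atLeast_one]
      simp)
    linarith
  have b2 : ∀ k, p * (1 - q) * (g (k + 1) - g (k + 2)) =
      q * (1 - p) * (g (k + 2) - g (k + 3)) := fun k => by
    have h := (ht (k + 2)).comp (tendsto_add_atTop_nat 1)
    have h' := (ht (k + 2)).add ((((ht (k + 1)).sub (ht (k + 2))).const_mul (p * (1 - q))).sub
      (((ht (k + 2)).sub (ht (k + 3))).const_mul (q * (1 - p))))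
    have e := tendsto_nhds_unique h (h'.congr fun t => by
      simp only [Function.comp, pow_succ, Module.End.mul_apply, linear_atLeast]
      simp)
    linarith
  have hle : g 1 ≤ 1 := hg0 ▸ hanti 0
  convert! ht 1 using 2
  split_ifs with hqp
  · -- subcritical access: the increments of `g` do not decrease, hence vanish
    by_contra hne
    have hpos : 0 < g 0 - g 1 := by
      rcases hle.lt_or_eq with h | h
      · linarith
      · exact absurd h.symm hne
    have hc : 0 < q * (1 - p) := by
      rcases (mul_nonneg hq hp').lt_or_eq with h | h
      · exact h
      · rw [← h, zero_mul] at b1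
        exact absurd b1 (by positivity)
    -- For `q ≤ p` both `p` and `p(1-q)` are at least `q(1-p)`, so by `b1` and `b2` each increment
    -- dominates the previous one. Then `g 0 - g n` grows at least linearly, against `g n ≥ 0`.
    have hstep : ∀ k, g 0 - g 1 ≤ g k - g (k + 1) := by
      intro k
      induction k with
      | zero => exact le_rfl
      | succ k ih =>
        refine ih.trans ?_
        rcases k with _ | k
        · refine le_of_mul_le_mul_left ?_ hc
          simp only [zero_add]
          rw [← b1]
          gcongr
          nlinarith
        · refine le_of_mul_le_mul_left ?_ hc
          rw [← b2 k]
          refine mul_le_mul_of_nonneg_right (by nlinarith) ?_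
          linarith [hanti (k + 1)]
    have hsum : ∀ n : ℕ, n * (g 0 - g 1) ≤ g 0 - g n := by
      intro n
      induction n with
      | zero => simp
      | succ n ih => push_cast; linarith [hstep n]
    obtain ⟨n, hn⟩ := exists_nat_gt (1 / (g 0 - g 1))
    rw [div_lt_iff₀ hpos] at hn
    linarith [hsum n, hnn n]
  · push Not at hqp
    have hq0 : 0 < q := hp.trans hqp
    rw [div_eq_iff hq0.ne']
    apply le_antisymm
    -- The balance equations telescope. As `n → ∞` they give `q * g 1 = p + (q - p) * G`, where `G ≥
    -- 0` is the mass that could escape to infinity; hence `q * g 1 ≥ p`.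
    · have hbal : ∀ n, p * (1 - g 1) = q * (1 - p) * (g 1 - g (n + 2)) -
          p * (1 - q) * (g 1 - g (n + 1)) := by
        intro n
        induction n with
        | zero => rw [hg0] at b1; simp only [zero_add, sub_self, mul_zero, sub_zero]; exact b1
        | succ n ih => rw [ih]; linarith [b2 n]
      obtain ⟨G, hG⟩ : ∃ G, Tendsto g atTop (𝓝 G) :=
        ⟨_, tendsto_atTop_ciInf (antitone_nat_of_succ_le hanti) ⟨0, by rintro _ ⟨k, rfl⟩; exact hnn k⟩⟩
      have hG0 : 0 ≤ G := ge_of_tendsto' hG hnn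
      have := tendsto_nhds_unique (tendsto_const_nhds (x := p * (1 - g 1)))
        ((((hG.comp (tendsto_add_atTop_nat 2)).const_sub (g 1)).const_mul (q * (1 - p))).sub
          (((hG.comp (tendsto_add_atTop_nat 1)).const_sub (g 1)).const_mul (p * (1 - q)))
          |>.congr fun n => (hbal n).symm)
      nlinarith [mul_nonneg (sub_nonneg.2 hqp.le) hG0]
    · by_contra! hlt
      -- otherwise the mean energy would become negative
      have h := (((ht 1).const_mul q).const_sub p)
      have hneg : p - q * g 1 < 0 := by linarith
      -- By `linear_pow_id` the Cesàro mean of the drift is the mean energy at time `n` divided by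
      -- `n`.
      obtain ⟨n, hn, hn0⟩ := ((h.cesaro.eventually (gt_mem_nhds hneg)).and
        (eventually_gt_atTop 0)).exists
      replace hn := (pos_iff_neg_of_mul_neg hn).1 (by positivity)
      have := linear_pow_id (p := p) (q := q) n 0
      rw [Nat.cast_zero, zero_add] at this
      rw [← this, ← iterate_eq_linear] at hn
      exact absurd (iterate_nonneg hp.le hp1 hq hq1 (fun e => by positivity) n 0) (not_le.2 hn)

/-- The limit probability that a battery is nonempty does not depend on the initial energy. -/
lemma tendsto_nonempty (hp : 0 < p) (hp1 : p ≤ 1) (hq : 0 ≤ q) (hq1 : q ≤ 1) (e : ℕ) :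
    Tendsto (fun t => (batteryStep p q)^[t] (atLeast 1) e) atTop
      (𝓝 (if q ≤ p then 1 else p / q)) := by
  have h0 := tendsto_start_zero hp hp1 hq hq1
  simp_rw [iterate_eq_linear]
  have hle : ∀ t, (linear p q ^ t) (atLeast 1) 0 ≤ (linear p q ^ t) (atLeast 1) e := fun t => by
    simp_rw [← iterate_eq_linear]
    exact iterate_monotone hp.le hp1 hq hq1 (atLeast_monotone 1) t (Nat.zero_le e)
  by_cases hqp : q ≤ p
  · rw [if_pos hqp] at h0 ⊢
    refine tendsto_of_tendsto_of_tendsto_of_le_of_le h0 tendsto_const_nhds hle fun t => ?_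
    simp only [← iterate_eq_linear]
    exact iterate_le_one hp.le hp1 hq hq1 (atLeast_le_one 1) t e
  · have hq0 : 0 < q := hp.trans (not_le.1 hqp)
    -- Subtract the mean energy identities for the starts `e` and `0`. The mean from `e` stays above
    -- the mean from `0`, so `q` times the partial sum is at most the initial gap `e`.
    have hsum : Summable fun t => (linear p q ^ t) (atLeast 1) e - (linear p q ^ t) (atLeast 1) 0 := by
      refine summable_of_sum_range_le (c := e / q) (fun t => sub_nonneg.2 (hle t)) fun n => ?_
      rw [le_div_iff₀ hq0]
      have h1 := linear_pow_id (p := p) (q := q) n e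
      have h2 := linear_pow_id (p := p) (q := q) n 0
      have h3 : (linear p q ^ n) (fun e : ℕ => (e : ℝ)) 0 ≤ (linear p q ^ n) (fun e : ℕ => (e : ℝ)) e := by
        simp_rw [← iterate_eq_linear]
        exact iterate_monotone hp.le hp1 hq hq1 Nat.mono_cast n (Nat.zero_le e)
      rw [h1, h2] at h3
      simp only [Finset.sum_sub_distrib, ← Finset.mul_sum] at h3 ⊢
      push_cast at h3
      linarith
    simpa using hsum.tendsto_atTop_zero.add h0

end batteryStep

/-! ### Generating functions of the Poisson law -/

/-- Weighting the Poisson law of mean `m` by `u ^ k` gives the Poisson law of mean `u * m` times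
`exp (-m(1-u))`. -/
lemma tsum_pow_mul_poissonMeasure (m : ℝ≥0) {u : ℝ≥0∞} (hu : u ≤ 1) :
    ∑' k : ℕ, u ^ k * poissonMeasure m {k} = negExp (m * (1 - u)) := by
  lift u to ℝ≥0 using (hu.trans_lt ENNReal.one_lt_top).ne
  have hu' : (u : ℝ) ≤ 1 := by exact_mod_cast hu
  have h := (hasSum_one_poissonMeasure (u * m)).mul_left (Real.exp (-(m * (1 - u))))
  have e : ∀ k : ℕ, (u : ℝ≥0∞) ^ k * poissonMeasure m {k} = ENNReal.ofReal
      (Real.exp (-(m * (1 - u))) * (Real.exp (-(u * m : ℝ≥0)) * (u * m : ℝ≥0) ^ k / k.factorial)) := by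
    intro k
    rw [poissonMeasure_singleton, ← ENNReal.ofReal_coe_nnreal, ← ENNReal.ofReal_pow u.coe_nonneg,
      ← ENNReal.ofReal_mul (by positivity)]
    congr 1
    have : Real.exp (-(m : ℝ)) = Real.exp (-(m * (1 - u))) * Real.exp (-(u * m : ℝ≥0)) := by
      rw [← Real.exp_add]; push_cast; ring_nf
    rw [this]; push_cast; ring
  simp_rw [e]
  rw [← ENNReal.ofReal_tsum_of_nonneg (fun k => by positivity) h.summable, h.tsum_eq, mul_one,
    ← negExp_ofReal (mul_nonneg m.coe_nonneg (sub_nonneg.2 hu')),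
    ENNReal.ofReal_mul m.coe_nonneg, ENNReal.ofReal_sub _ u.coe_nonneg]
  simp

/-- The Mecke formula for one cell: `(k+1) P(k+1) = m P(k)`, so choosing a point and removing it
leaves a Poisson count again, with factor `m`. -/
lemma tsum_mul_pow_mul_poissonMeasure (m : ℝ≥0) {u : ℝ≥0∞} (hu : u ≤ 1) :
    ∑' k : ℕ, k * u ^ (k - 1) * poissonMeasure m {k} = m * negExp (m * (1 - u)) := by
  rw [tsum_eq_zero_add' ENNReal.summable, ← tsum_pow_mul_poissonMeasure m hu, ← ENNReal.tsum_mul_left]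
  simp only [Nat.cast_zero, zero_mul, zero_add, Nat.add_sub_cancel]
  refine tsum_congr fun k => ?_
  have : ((k + 1 : ℕ) : ℝ≥0∞) * poissonMeasure m {k + 1} = m * poissonMeasure m {k} := by
    rw [poissonMeasure_singleton, poissonMeasure_singleton, ← ENNReal.ofReal_coe_nnreal,
      ← ENNReal.ofReal_natCast, ← ENNReal.ofReal_mul (by positivity), ← ENNReal.ofReal_mul (by positivity)]
    congr 1
    rw [Nat.factorial_succ]
    push_cast
    field_simp
    ring
  rw [mul_right_comm, this]; ring

/-! ### Counts of the Poisson process -/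

namespace IsPoissonPointProcess

variable {Ω : Type*} [MeasurableSpace Ω] {P : Measure Ω} {lam : ℝ} {X : ℕ → Ω → Plane}

lemma toENNReal_pointCount {Ω : Type*} (X : ℕ → Ω → Plane) (B : Set Plane) (ω : Ω) :
    (pointCount X B ω : ℝ≥0∞) = ∑' n, B.indicator 1 (X n ω) := by
  rw [pointCount, ← ENNReal.tsum_set_one]
  exact tsum_subtype {m | X m ω ∈ B} fun _ => (1 : ℝ≥0∞)

lemma measurable_pointCount (h : IsPoissonPointProcess P lam X) {B : Set Plane}
    (hB : MeasurableSet B) : Measurable (pointCount X B) := by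
  have h1 : Measurable fun ω => (pointCount X B ω : ℝ≥0∞) := by
    simp_rw [toENNReal_pointCount]
    exact Measurable.tsum fun n => (measurable_one.indicator hB).comp (h.measurable n)
  refine measurable_to_countable' fun k => ?_
  convert! h1 (measurableSet_singleton (k : ℝ≥0∞)) using 1
  ext ω
  simp

lemma toNNReal_mean (hlam : 0 ≤ lam) {B : Set Plane} (hB : volume B < ∞) :
    (Real.toNNReal (lam * (volume B).toReal) : ℝ≥0∞) = ENNReal.ofReal lam * volume B := by
  change ENNReal.ofReal _ = _
  rw [ENNReal.ofReal_mul hlam, ENNReal.ofReal_toReal hB.ne]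

/-- The Poisson masses of the finite values already sum to `1`. -/
lemma ae_pointCount_ne_top [IsProbabilityMeasure P] (h : IsPoissonPointProcess P lam X)
    {B : Set Plane} (hB : MeasurableSet B) (hB' : volume B < ∞) :
    ∀ᵐ ω ∂P, pointCount X B ω ≠ ⊤ := by
  have hm : ∀ k : ℕ, MeasurableSet {ω | pointCount X B ω = k} := fun k =>
    h.measurable_pointCount hB (measurableSet_singleton _)
  have h1 : P (⋃ k : ℕ, {ω | pointCount X B ω = k}) = 1 := by
    rw [measure_iUnion _ hm]
    · simp_rw [h.count_law B hB hB']
      rw [← measure_univ (μ := poissonMeasure (Real.toNNReal (lam * (volume B).toReal))),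
        ← Measure.tsum_indicator_apply_singleton _ _ MeasurableSet.univ]
      simp
    · intro k l hkl
      refine Set.disjoint_left.2 fun ω h1 h2 => hkl ?_
      simp only [Set.mem_ofPred_eq] at h1 h2
      exact_mod_cast h1.symm.trans h2
  have h2 := (prob_compl_eq_zero_iff (MeasurableSet.iUnion hm)).2 h1
  filter_upwards [compl_mem_ae_iff.2 h2] with ω hω
  simp only [compl_compl, Set.mem_iUnion, Set.mem_ofPred_eq] at hω
  obtain ⟨k, hk⟩ := hω
  simp [hk]

lemma lintegral_comp_pointCount [IsProbabilityMeasure P] (h : IsPoissonPointProcess P lam X)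
    {B : Set Plane} (hB : MeasurableSet B) (hB' : volume B < ∞) (F : ℕ∞ → ℝ≥0∞) :
    ∫⁻ ω, F (pointCount X B ω) ∂P =
      ∑' k : ℕ, F k * poissonMeasure (Real.toNNReal (lam * (volume B).toReal)) {k} := by
  have hm : ∀ k : ℕ, MeasurableSet {ω | pointCount X B ω = k} := fun k =>
    h.measurable_pointCount hB (measurableSet_singleton _)
  have : ∫⁻ ω, F (pointCount X B ω) ∂P =
      ∫⁻ ω, ∑' k : ℕ, {ω | pointCount X B ω = k}.indicator (fun _ => F k) ω ∂P := by
    refine lintegral_congr_ae ?_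
    filter_upwards [h.ae_pointCount_ne_top hB hB'] with ω hω
    lift pointCount X B ω to ℕ using hω with k hk
    rw [tsum_eq_single k]
    · simp [hk]
    · intro l hl
      refine Set.indicator_of_notMem ?_ _
      simp only [Set.mem_ofPred_eq, ← hk]
      exact_mod_cast hl.symm
  rw [this, lintegral_tsum fun k => (measurable_const.indicator (hm k)).aemeasurable]
  refine tsum_congr fun k => ?_
  rw [lintegral_indicator_const (hm k), h.count_law B hB hB']

lemma lintegral_prod_comp_pointCount [IsProbabilityMeasure P] (h : IsPoissonPointProcess P lam X)
    {J : Type*} [Fintype J] {C : J → Set Plane} (hC : ∀ j, MeasurableSet (C j))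
    (hC' : ∀ j, volume (C j) < ∞) (hd : Pairwise fun i j => Disjoint (C i) (C j))
    (F : J → ℕ∞ → ℝ≥0∞) :
    ∫⁻ ω, ∏ j, F j (pointCount X (C j) ω) ∂P = ∏ j, ∫⁻ ω, F j (pointCount X (C j) ω) ∂P := by
  let e := (Fintype.equivFin J).symm
  have hi := h.count_indep (Fintype.card J) (fun k => C (e k)) (fun k => hC _) (fun k => hC' _)
    (fun i j hij => hd (e.injective.ne hij))
  have hi' := hi.comp (fun k => F (e k)) fun k => measurable_from_top
  have hp := lintegral_prod_eq_prod_lintegral_of_indepFun Finset.univ _ hi' fun k =>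
    (measurable_from_top (f := F (e k))).comp (h.measurable_pointCount (hC (e k)))
  simp only [Function.comp] at hp
  rw [← e.prod_comp, ← hp]
  refine lintegral_congr fun ω => ?_
  rw [← e.prod_comp]

end IsPoissonPointProcess

/-! ### Mecke formula on a finite partition -/

/-- The sum over the points `x n` in the cell `C i` of `negExp` of the sum over the other points of
a weight that is constant on cells, in terms of the cell counts. -/
lemma tsum_indicator_mul_negExp_cells {E J : Type*} [Fintype J] [DecidableEq J] (x : ℕ → E)
    (C : J → Set E)
    (hd : Pairwise fun i j => Disjoint (C i) (C j)) (hx : ∀ j, {m | x m ∈ C j}.encard ≠ ⊤)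
    (c : J → ℝ≥0∞) (i : J) :
    ∑' n, (C i).indicator 1 (x n) *
        negExp (∑' s, if s = n then 0 else ∑ j, (C j).indicator (fun _ => c j) (x s)) =
      ∏ j, (if j = i then ({m | x m ∈ C j}.encard : ℝ≥0∞) *
          negExp (c j) ^ ({m | x m ∈ C j}.encard.toNat - 1)
        else negExp (c j) ^ {m | x m ∈ C j}.encard.toNat) := by
  set N : J → ℕ := fun j => {m | x m ∈ C j}.encard.toNat with hN
  have hN' : ∀ j, {m | x m ∈ C j}.encard = N j := fun j => (ENat.natCast_toNat (hx j)).symm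
  -- Removing the point `n` lowers the count of its own cell `i` by one and no other, so the summand
  -- is the same for all points of `C i` and the sum over `n` contributes the factor `N i`. If `N i
  -- = 0` this factor makes the truncated `N i - 1` irrelevant.
  have key : ∀ n, x n ∈ C i →
      negExp (∑' s, if s = n then 0 else ∑ j, (C j).indicator (fun _ => c j) (x s)) =
        ∏ j, negExp (c j) ^ (if j = i then N j - 1 else N j) := by
    intro n hn
    have h1 : ∀ s, (if s = n then 0 else ∑ j, (C j).indicator (fun _ => c j) (x s)) =
        ∑ j, ({m | x m ∈ C j} \ {n}).indicator 1 s * c j := by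
      intro s
      split_ifs with hs
      · simp [hs]
      · refine Finset.sum_congr rfl fun j _ => ?_
        by_cases hj : x s ∈ C j
        · rw [Set.indicator_of_mem hj,
            Set.indicator_of_mem (show s ∈ {m | x m ∈ C j} \ {n} from ⟨hj, hs⟩)]; simp
        · rw [Set.indicator_of_notMem hj, Set.indicator_of_notMem fun h => hj h.1]; simp
    simp_rw [h1]
    rw [Summable.tsum_finsetSum fun _ _ => ENNReal.summable, negExp_sum]
    refine Finset.prod_congr rfl fun j _ => ?_
    rw [ENNReal.tsum_mul_right, ← negExp_nat_mul]
    congr 2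
    have h2 : ∑' s, ({m | x m ∈ C j} \ {n}).indicator (1 : ℕ → ℝ≥0∞) s =
        (({m | x m ∈ C j} \ {n}).encard : ℝ≥0∞) := by
      rw [← ENNReal.tsum_set_one]
      exact (tsum_subtype ({m | x m ∈ C j} \ {n}) fun _ => (1 : ℝ≥0∞)).symm
    rw [h2]
    split_ifs with hj
    · subst hj
      have h3 := Set.encard_sdiff_singleton_add_one (s := {m | x m ∈ C j}) (a := n) hn
      have h4 : ({m | x m ∈ C j} \ {n}).encard ≠ ⊤ := fun h => by
        rw [h, top_add] at h3; exact hx j h3.symm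
      lift ({m | x m ∈ C j} \ {n}).encard to ℕ using h4 with k
      rw [hN'] at h3
      have : k + 1 = N j := by exact_mod_cast h3
      rw [← this]; simp
    · rw [Set.sdiff_singleton_eq_self, hN']
      · simp
      · exact fun h => Set.disjoint_left.1 (hd hj) h hn
  have h5 : ∀ n, (C i).indicator 1 (x n) *
      negExp (∑' s, if s = n then 0 else ∑ j, (C j).indicator (fun _ => c j) (x s)) =
      (C i).indicator 1 (x n) * ∏ j, negExp (c j) ^ (if j = i then N j - 1 else N j) := by
    intro n
    by_cases hn : x n ∈ C i
    · rw [key n hn]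
    · simp [hn]
  have h6 : ∑' n, (C i).indicator (1 : E → ℝ≥0∞) (x n) = ({m | x m ∈ C i}.encard : ℝ≥0∞) := by
    rw [← ENNReal.tsum_set_one]
    exact (tsum_subtype {m | x m ∈ C i} fun _ => (1 : ℝ≥0∞)).symm
  simp_rw [h5]
  rw [ENNReal.tsum_mul_right, h6, ← Finset.mul_prod_erase _ _ (Finset.mem_univ i),
    ← Finset.mul_prod_erase _ _ (Finset.mem_univ i), if_pos rfl, if_pos rfl, ← mul_assoc]
  congr 1
  refine Finset.prod_congr rfl fun j hj => ?_
  rw [if_neg (Finset.ne_of_mem_erase hj), if_neg (Finset.ne_of_mem_erase hj)]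

namespace IsPoissonPointProcess

variable {Ω : Type*} [MeasurableSpace Ω] {P : Measure Ω} {lam : ℝ} {X : ℕ → Ω → Plane}

/-- The Mecke formula for weights that are constant on the cells of a finite partition. -/
lemma lintegral_tsum_cells [IsProbabilityMeasure P] (h : IsPoissonPointProcess P lam X)
    (hlam : 0 ≤ lam) {J : Type*} [Fintype J] {C : J → Set Plane} (hC : ∀ j, MeasurableSet (C j))
    (hC' : ∀ j, volume (C j) < ∞) (hd : Pairwise fun i j => Disjoint (C i) (C j))
    (c : J → ℝ≥0∞) (i : J) :
    ∫⁻ ω, ∑' n, (C i).indicator 1 (X n ω) *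
        negExp (∑' s, if s = n then 0 else ∑ j, (C j).indicator (fun _ => c j) (X s ω)) ∂P =
      ENNReal.ofReal lam * volume (C i) *
        negExp (ENNReal.ofReal lam * ∑ j, volume (C j) * (1 - negExp (c j))) := by
  classical
  have h1 := lintegral_prod_comp_pointCount h hC hC' hd fun j N =>
    if j = i then (N : ℝ≥0∞) * negExp (c j) ^ (N.toNat - 1) else negExp (c j) ^ N.toNat
  -- The cell `i` contributes `E[N u^(N-1)]` and the others `E[u^N]`; they differ only by the mean
  -- of the count.
  have h2 : ∀ j, ∫⁻ ω, (if j = i then (pointCount X (C j) ω : ℝ≥0∞) *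
      negExp (c j) ^ ((pointCount X (C j) ω).toNat - 1)
      else negExp (c j) ^ (pointCount X (C j) ω).toNat) ∂P =
      (if j = i then ENNReal.ofReal lam * volume (C j) else 1) *
        negExp (ENNReal.ofReal lam * (volume (C j) * (1 - negExp (c j)))) := by
    intro j
    rw [lintegral_comp_pointCount h (hC j) (hC' j) fun N =>
      if j = i then (N : ℝ≥0∞) * negExp (c j) ^ (N.toNat - 1) else negExp (c j) ^ N.toNat,
      ← mul_assoc, ← toNNReal_mean hlam (hC' j)]
    split_ifs
    · rw [← tsum_mul_pow_mul_poissonMeasure _ (negExp_le_one _)]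
      simp
    · rw [one_mul, ← tsum_pow_mul_poissonMeasure _ (negExp_le_one _)]
      simp
  simp_rw [h2] at h1
  rw [Finset.prod_mul_distrib, ← negExp_sum, ← Finset.mul_sum, Finset.prod_ite_eq' Finset.univ i,
    if_pos (Finset.mem_univ i)] at h1
  rw [← h1]
  refine lintegral_congr_ae ?_
  filter_upwards [ae_all_iff.2 fun j => h.ae_pointCount_ne_top (hC j) (hC' j)] with ω hω
  exact tsum_indicator_mul_negExp_cells (fun n => X n ω) C hd hω c i

end IsPoissonPointProcess

/-! ### Approximation by functions of finitely many cells -/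

section Coarsening

variable {E : Type*} (U : ℕ → Set E) (k : ℕ)

/-- Which of the first `k` sets of the sequence `U` contain the point `x`. -/
def cellLabel (x : E) : Fin k → Prop := fun i => x ∈ U i

/-- The cell with label `a` of the finite partition generated by the first `k` sets of `U`. -/
def labelCell (a : Fin k → Prop) : Set E := {x | cellLabel U k x = a}

open Classical in
/-- The infimum of `g` over a pair of cells, cut off to `0` where the second cell has infinite
measure. -/
noncomputable def coarsen [MeasureSpace E] (g : E → E → ℝ≥0∞) (a b : Fin k → Prop) : ℝ≥0∞ :=
  if volume (labelCell U k b) < ∞ then ⨅ x ∈ labelCell U k a, ⨅ z ∈ labelCell U k b, g x z else 0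

variable {U k}

lemma mem_labelCell_self (x : E) : x ∈ labelCell U k (cellLabel U k x) := rfl

lemma mem_labelCell_cellLabel_iff {x y : E} :
    y ∈ labelCell U k (cellLabel U k x) ↔ ∀ i < k, (y ∈ U i ↔ x ∈ U i) := by
  simp only [labelCell, cellLabel, Set.mem_ofPred_eq, funext_iff, eq_iff_iff, Fin.forall_iff]

lemma labelCell_anti {l : ℕ} (h : k ≤ l) (x : E) :
    labelCell U l (cellLabel U l x) ⊆ labelCell U k (cellLabel U k x) := fun _ hy =>
  mem_labelCell_cellLabel_iff.2 fun i hi => mem_labelCell_cellLabel_iff.1 hy i (hi.trans_le h)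

lemma labelCell_subset {i : ℕ} (hi : i < k) {x : E} (hx : x ∈ U i) :
    labelCell U k (cellLabel U k x) ⊆ U i := fun _ hy =>
  (mem_labelCell_cellLabel_iff.1 hy i hi).2 hx

lemma pairwise_disjoint_labelCell :
    Pairwise fun a b => Disjoint (labelCell U k a) (labelCell U k b) := fun _ _ hab =>
  Set.disjoint_left.2 fun _ hx hy => hab (hx.symm.trans hy)

lemma measurable_cellLabel [MeasurableSpace E] (hU : ∀ i, MeasurableSet (U i)) :
    Measurable (cellLabel U k) :=
  measurable_pi_lambda _ fun i => measurableSet_setOfPred.1 (hU i)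

lemma measurableSet_labelCell [MeasurableSpace E] (hU : ∀ i, MeasurableSet (U i))
    (a : Fin k → Prop) : MeasurableSet (labelCell U k a) :=
  measurable_cellLabel hU (measurableSet_singleton a)

open Classical in
/-- A function of the cell, as a sum over the cells of finite measure. -/
lemma comp_cellLabel_eq_sum [MeasureSpace E] (H : (Fin k → Prop) → ℝ≥0∞)
    (hH : ∀ a, ¬ volume (labelCell U k a) < ∞ → H a = 0) (x : E) :
    H (cellLabel U k x) = ∑ b : {a : Fin k → Prop // volume (labelCell U k a) < ∞},
      (labelCell U k b.1).indicator (fun _ => H b.1) x := by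
  by_cases hx : volume (labelCell U k (cellLabel U k x)) < ∞
  · rw [Finset.sum_eq_single ⟨_, hx⟩]
    · rw [Set.indicator_of_mem (mem_labelCell_self x)]
    · intro b _ hb
      refine Set.indicator_of_notMem (fun h => hb (Subtype.ext h.symm)) _
    · simp
  · rw [hH _ hx, Finset.sum_eq_zero]
    intro b _
    refine Set.indicator_of_notMem (fun h => hx ?_) _
    have : cellLabel U k x = b.1 := h
    rw [this]; exact b.2

lemma coarsen_eq_zero [MeasureSpace E] (g : E → E → ℝ≥0∞) (a b : Fin k → Prop)
    (hb : ¬ volume (labelCell U k b) < ∞) : coarsen U k g a b = 0 := if_neg hb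

/-- Smaller cells have larger infima, and a cell of finite measure stays so under refinement. -/
lemma coarsen_monotone [MeasureSpace E] (g : E → E → ℝ≥0∞) (x z : E) :
    Monotone fun k => coarsen U k g (cellLabel U k x) (cellLabel U k z) := by
  intro k l hkl
  simp only [coarsen]
  split_ifs with h1 h2
  · exact le_iInf₂ fun x' hx' => le_iInf₂ fun z' hz' =>
      (iInf₂_le x' (labelCell_anti hkl x hx')).trans (iInf₂_le z' (labelCell_anti hkl z hz'))
  · exact absurd ((measure_mono (labelCell_anti hkl z)).trans_lt h1) h2
  · exact zero_le
  · exact le_rfl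

/-- If `s < g x z`, continuity gives neighbourhoods of `x` and `z` on whose product `g > s`, and at
a finite stage the cells lie inside them. The neighbourhood of `z` is also taken of finite measure,
so that the cut-off is inactive there. -/
lemma tendsto_coarsen [MeasureSpace E] [TopologicalSpace E]
    [IsLocallyFiniteMeasure (volume : Measure E)] {g : E → E → ℝ≥0∞}
    (hg : Continuous (Function.uncurry g))
    (hbasis : ∀ (x : E) (O : Set E), IsOpen O → x ∈ O → ∃ i, x ∈ U i ∧ U i ⊆ O) (x z : E) :
    Tendsto (fun k => coarsen U k g (cellLabel U k x) (cellLabel U k z)) atTop (𝓝 (g x z)) := by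
  have hle : ∀ k, coarsen U k g (cellLabel U k x) (cellLabel U k z) ≤ g x z := fun k => by
    unfold coarsen
    split_ifs
    · exact (iInf₂_le x (mem_labelCell_self x)).trans (iInf₂_le z (mem_labelCell_self z))
    · exact zero_le
  convert! tendsto_atTop_iSup (coarsen_monotone (U := U) g x z) using 2
  refine le_antisymm (le_of_forall_lt fun t ht => ?_) (iSup_le hle)
  obtain ⟨s, hts, hs⟩ := exists_between ht
  have ho : IsOpen {q : E × E | s < Function.uncurry g q} := isOpen_lt continuous_const hg
  obtain ⟨u, v, hu, hv, hxu, hzv, huv⟩ := isOpen_prod_iff.1 ho x z hs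
  obtain ⟨w, hzw, hwo, hw⟩ := (volume : Measure E).exists_isOpen_measure_lt_top z
  obtain ⟨i, hi, hiu⟩ := hbasis x u hu hxu
  obtain ⟨j, hj, hjv⟩ := hbasis z (v ∩ w) (hv.inter hwo) ⟨hzv, hzw⟩
  refine hts.trans_le (le_iSup_of_le (max i j + 1) ?_)
  have h1 := (labelCell_subset (k := max i j + 1) (by lia) hi).trans hiu
  have h2 := (labelCell_subset (k := max i j + 1) (by lia) hj).trans hjv
  rw [coarsen, if_pos ((measure_mono (h2.trans Set.inter_subset_right)).trans_lt hw)]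
  exact le_iInf₂ fun x' hx' => le_iInf₂ fun z' hz' =>
    (huv (Set.mk_mem_prod (h1 hx') (h2 hz').1) : s < Function.uncurry g (x', z')).le

/-- The window `A` comes first so that, from stage `1` on, membership in `A` is decided by the cell.
-/
lemma exists_seq_basis [TopologicalSpace E] [SecondCountableTopology E] [MeasurableSpace E]
    [OpensMeasurableSpace E] {A : Set E} (hA : MeasurableSet A) :
    ∃ U : ℕ → Set E, U 0 = A ∧ (∀ i, MeasurableSet (U i)) ∧
      ∀ (x : E) (O : Set E), IsOpen O → x ∈ O → ∃ i, x ∈ U i ∧ U i ⊆ O := by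
  obtain ⟨b, hbc, -, hb⟩ := TopologicalSpace.exists_countable_basis E
  have hc : (insert ∅ b).Countable := hbc.insert _
  obtain ⟨V, hV⟩ := hc.exists_eq_range (Set.insert_nonempty _ _)
  refine ⟨fun n => Nat.casesOn n A V, rfl, ?_, ?_⟩
  · rintro (_ | i)
    · exact hA
    · have : V i ∈ insert ∅ b := hV ▸ Set.mem_range_self i
      rcases this with h | h
      · simp [h]
      · exact (hb.isOpen h).measurableSet
  · intro x O hO hx
    obtain ⟨v, hv, hxv, hvO⟩ := hb.exists_subset_of_mem_open hx hO
    obtain ⟨i, rfl⟩ : v ∈ Set.range V := hV ▸ Set.mem_insert_of_mem _ hv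
    exact ⟨i + 1, hxv, hvO⟩

end Coarsening

/-! ### Mecke formula for continuous weights -/

namespace IsPoissonPointProcess

variable {Ω : Type*} [MeasurableSpace Ω] {P : Measure Ω} {lam : ℝ} {X : ℕ → Ω → Plane}

/-- Campbell's formula, as the case of a single cell with weight `0`. -/
lemma lintegral_tsum_indicator [IsProbabilityMeasure P] (h : IsPoissonPointProcess P lam X)
    (hlam : 0 ≤ lam) {A : Set Plane} (hA : MeasurableSet A) (hA' : volume A < ∞) :
    ∫⁻ ω, ∑' n, A.indicator 1 (X n ω) ∂P = ENNReal.ofReal lam * volume A := by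
  simpa using h.lintegral_tsum_cells hlam (J := Unit) (C := fun _ => A) (fun _ => hA)
    (fun _ => hA') Subsingleton.pairwise (fun _ => 0) ()

open Classical in
/-- The Mecke formula for coarsened weights. -/
lemma lintegral_tsum_coarsen [IsProbabilityMeasure P] (h : IsPoissonPointProcess P lam X)
    (hlam : 0 ≤ lam) {A : Set Plane} (hA' : volume A < ∞) {U : ℕ → Set Plane} (hUA : U 0 = A)
    (hU : ∀ i, MeasurableSet (U i)) (g : Plane → Plane → ℝ≥0∞) (k : ℕ) (hk : 0 < k) :
    ∫⁻ ω, ∑' n, A.indicator 1 (X n ω) * negExp (∑' s, if s = n then 0 else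
        coarsen U k g (cellLabel U k (X n ω)) (cellLabel U k (X s ω))) ∂P =
      ∫⁻ x in A, ENNReal.ofReal lam * negExp (ENNReal.ofReal lam *
        ∫⁻ z, (1 - negExp (coarsen U k g (cellLabel U k x) (cellLabel U k z)))) := by
  set J := {a : Fin k → Prop // volume (labelCell U k a) < ∞} with hJ
  set C : J → Set Plane := fun j => labelCell U k j.1 with hCdef
  have hC : ∀ j, MeasurableSet (C j) := fun j => measurableSet_labelCell hU _
  have hC' : ∀ j, volume (C j) < ∞ := fun j => j.2
  have hd : Pairwise fun i j => Disjoint (C i) (C j) := fun i j hij =>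
    pairwise_disjoint_labelCell (Subtype.coe_injective.ne hij)
  -- Membership in `A = U 0` is the coordinate `0` of the label, which exists because `k > 0`.
  let HA : (Fin k → Prop) → ℝ≥0∞ := fun a => if a ⟨0, hk⟩ then 1 else 0
  have hHA0 : ∀ x, A.indicator (1 : Plane → ℝ≥0∞) x = HA (cellLabel U k x) := fun x => by
    simp only [HA, cellLabel, hUA, Set.indicator_apply, Pi.one_apply]
  have hfin : ∀ a : Fin k → Prop, ¬ volume (labelCell U k a) < ∞ → HA a = 0 := fun a ha => by
    refine if_neg fun h0 => ha ((measure_mono fun x hx => ?_).trans_lt hA')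
    have hx' : cellLabel U k x = a := hx
    rw [← hx'] at h0
    exact hUA ▸ h0
  have hHA : ∀ x, A.indicator (1 : Plane → ℝ≥0∞) x =
      ∑ b : J, (C b).indicator (fun _ => HA b.1) x := fun x =>
    (hHA0 x).trans (comp_cellLabel_eq_sum HA hfin x)
  have hW : ∀ (a : Fin k → Prop) (z : Plane), coarsen U k g a (cellLabel U k z) =
      ∑ b : J, (C b).indicator (fun _ => coarsen U k g a b.1) z := fun a z =>
    comp_cellLabel_eq_sum (fun b => coarsen U k g a b) (coarsen_eq_zero g a) z
  have hV : ∀ a : Fin k → Prop, ∫⁻ z, (1 - negExp (coarsen U k g a (cellLabel U k z))) =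
      ∑ b : J, volume (C b) * (1 - negExp (coarsen U k g a b.1)) := by
    intro a
    have : ∀ z, 1 - negExp (coarsen U k g a (cellLabel U k z)) =
        ∑ b : J, (C b).indicator (fun _ => 1 - negExp (coarsen U k g a b.1)) z := fun z =>
      comp_cellLabel_eq_sum (fun b => 1 - negExp (coarsen U k g a b))
        (fun b hb => by simp [coarsen_eq_zero g a b hb]) z
    simp_rw [this]
    rw [lintegral_finsetSum _ fun b _ => measurable_const.indicator (hC b)]
    refine Finset.sum_congr rfl fun b _ => ?_
    rw [lintegral_indicator_const (hC b), mul_comm]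
  -- Sorting the typical point by its cell freezes the first argument of the weight, as
  -- `lintegral_tsum_cells` requires.
  have hsplit : ∀ (x : Plane) (F : (Fin k → Prop) → ℝ≥0∞),
      A.indicator 1 x * F (cellLabel U k x) =
        ∑ b : J, HA b.1 * ((C b).indicator 1 x * F b.1) := by
    intro x F
    rw [hHA, Finset.sum_mul]
    refine Finset.sum_congr rfl fun b _ => ?_
    by_cases hx : x ∈ C b
    · have hx' : cellLabel U k x = b.1 := hx
      simp [Set.indicator_of_mem hx, hx']
    · simp [Set.indicator_of_notMem hx]
  have hR : ∫⁻ x in A, ENNReal.ofReal lam * negExp (ENNReal.ofReal lam *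
        ∫⁻ z, (1 - negExp (coarsen U k g (cellLabel U k x) (cellLabel U k z)))) =
      ∑ b : J, HA b.1 * (ENNReal.ofReal lam * volume (C b) * negExp (ENNReal.ofReal lam *
        ∑ j : J, volume (C j) * (1 - negExp (coarsen U k g b.1 j.1)))) := by
    rw [← lintegral_indicator (hUA ▸ hU 0)]
    have : ∀ x, A.indicator (fun x => ENNReal.ofReal lam * negExp (ENNReal.ofReal lam *
        ∫⁻ z, (1 - negExp (coarsen U k g (cellLabel U k x) (cellLabel U k z))))) x =
        ∑ b : J, HA b.1 * ((C b).indicator 1 x * (ENNReal.ofReal lam * negExp (ENNReal.ofReal lam *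
          ∑ j : J, volume (C j) * (1 - negExp (coarsen U k g b.1 j.1))))) := by
      intro x
      rw [← hsplit x fun a => ENNReal.ofReal lam * negExp (ENNReal.ofReal lam *
          ∑ j : J, volume (C j) * (1 - negExp (coarsen U k g a j.1)))]
      by_cases hx : x ∈ A <;> simp [hx, hV]
    simp_rw [this]
    have hm : ∀ b : J, Measurable ((C b).indicator (1 : Plane → ℝ≥0∞)) := fun b =>
      measurable_one.indicator (hC b)
    rw [lintegral_finsetSum _ fun b _ => ((hm b).mul_const _).const_mul _]
    refine Finset.sum_congr rfl fun b _ => ?_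
    rw [lintegral_const_mul _ ((hm b).mul_const _), lintegral_mul_const _ (hm b),
      lintegral_indicator_one (hC b)]
    ring
  have hL : ∀ ω, ∑' n, A.indicator 1 (X n ω) * negExp (∑' s, if s = n then 0 else
        coarsen U k g (cellLabel U k (X n ω)) (cellLabel U k (X s ω))) =
      ∑ b : J, HA b.1 * ∑' n, (C b).indicator 1 (X n ω) * negExp (∑' s, if s = n then 0 else
        ∑ j : J, (C j).indicator (fun _ => coarsen U k g b.1 j.1) (X s ω)) := by
    intro ω
    simp_rw [← ENNReal.tsum_mul_left]
    rw [← Summable.tsum_finsetSum fun _ _ => ENNReal.summable]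
    refine tsum_congr fun n => ?_
    rw [hsplit (X n ω) fun a => negExp (∑' s, if s = n then 0 else
        coarsen U k g a (cellLabel U k (X s ω)))]
    simp_rw [hW]
  have hmeas : ∀ b : J, Measurable fun ω => ∑' n, (C b).indicator (1 : Plane → ℝ≥0∞) (X n ω) *
      negExp (∑' s, if s = n then 0 else
        ∑ j : J, (C j).indicator (fun _ => coarsen U k g b.1 j.1) (X s ω)) := by
    intro b
    refine Measurable.tsum fun n => ((measurable_one.indicator (hC b)).comp (h.measurable n)).mul
      (measurable_negExp.comp (Measurable.tsum fun s => ?_))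
    split_ifs
    · exact measurable_const
    · exact Finset.measurable_fun_sum _ fun j _ =>
        (measurable_const.indicator (hC j)).comp (h.measurable s)
  rw [hR]
  simp_rw [hL]
  rw [lintegral_finsetSum _ fun b _ => (hmeas b).const_mul _]
  refine Finset.sum_congr rfl fun b _ => ?_
  rw [lintegral_const_mul _ (hmeas b)]
  congr 1
  exact h.lintegral_tsum_cells hlam hC hC' hd (fun j => coarsen U k g b.1 j.1) b

/-- The Mecke formula: for a typical point `x` in `A` of a Poisson process, the other points form a
Poisson process of the same density. -/
theorem lintegral_tsum_negExp [IsProbabilityMeasure P] (h : IsPoissonPointProcess P lam X)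
    (hlam : 0 ≤ lam) {A : Set Plane} (hA : MeasurableSet A) (hA' : volume A < ∞)
    {g : Plane → Plane → ℝ≥0∞} (hg : Continuous (Function.uncurry g)) :
    ∫⁻ ω, ∑' n, A.indicator 1 (X n ω) *
        negExp (∑' s, if s = n then 0 else g (X n ω) (X s ω)) ∂P =
      ∫⁻ x in A, ENNReal.ofReal lam *
        negExp (ENNReal.ofReal lam * ∫⁻ z, (1 - negExp (g x z))) := by
  obtain ⟨U, hUA, hU, hb⟩ := exists_seq_basis hA
  have hmW : ∀ k, Measurable (Function.uncurry (coarsen U k g)) := fun k => measurable_of_finite _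
  have hml : ∀ k, Measurable (cellLabel U k) := fun k => measurable_cellLabel hU
  have hmX : ∀ k n, Measurable fun ω => cellLabel U k (X n ω) := fun k n =>
    (hml k).comp (h.measurable n)
  have hmI : ∀ n, Measurable fun ω => A.indicator (1 : Plane → ℝ≥0∞) (X n ω) := fun n =>
    (measurable_one.indicator hA).comp (h.measurable n)
  -- both sides are limits along the coarsenings
  have hS : ∀ ω n, Tendsto (fun k => ∑' s, if s = n then 0 else
      coarsen U k g (cellLabel U k (X n ω)) (cellLabel U k (X s ω))) atTop
      (𝓝 (∑' s, if s = n then 0 else g (X n ω) (X s ω))) := by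
    intro ω n
    simp_rw [← lintegral_count]
    refine lintegral_tendsto_of_tendsto_of_monotone (fun k => measurable_from_top.aemeasurable)
      (ae_of_all _ fun s k l hkl => ?_) (ae_of_all _ fun s => ?_)
    · split_ifs
      · exact le_rfl
      · exact coarsen_monotone g _ _ hkl
    · split_ifs
      · exact tendsto_const_nhds
      · exact tendsto_coarsen hg hb _ _
  have hle : ∀ (x y : ℝ≥0∞), x * negExp y ≤ x := fun x y =>
    (mul_le_mul_right (negExp_le_one y) x).trans_eq (mul_one x)
  have hN := h.lintegral_tsum_indicator hlam hA hA'
  have hNfin : ∫⁻ ω, ∑' n, A.indicator 1 (X n ω) ∂P ≠ ∞ := by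
    rw [hN]; exact ENNReal.mul_ne_top ENNReal.ofReal_ne_top hA'.ne
  -- Dominated convergence twice: over `Ω` with the number of points in `A`, which has finite mean,
  -- and for almost every `ω` over `n` with the indicators of the points in `A`.
  have hlhs : Tendsto (fun k => ∫⁻ ω, ∑' n, A.indicator 1 (X n ω) * negExp (∑' s, if s = n then 0 else
        coarsen U k g (cellLabel U k (X n ω)) (cellLabel U k (X s ω))) ∂P) atTop
      (𝓝 (∫⁻ ω, ∑' n, A.indicator 1 (X n ω) *
        negExp (∑' s, if s = n then 0 else g (X n ω) (X s ω)) ∂P)) := by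
    refine tendsto_lintegral_of_dominated_convergence _ (fun k => ?_)
      (fun k => ae_of_all _ fun ω => ENNReal.tsum_le_tsum fun n => hle _ _) hNfin ?_
    · refine Measurable.tsum fun n => (hmI n).mul (measurable_negExp.comp
        (Measurable.tsum fun s => ?_))
      split_ifs
      · exact measurable_const
      · exact (hmW k).comp ((hmX k n).prodMk (hmX k s))
    · filter_upwards [ae_lt_top (Measurable.tsum hmI) hNfin] with ω hω
      simp_rw [← lintegral_count] at hω ⊢
      refine tendsto_lintegral_of_dominated_convergence _ (fun k => measurable_from_top)
        (fun k => ae_of_all _ fun n => hle _ _) hω.ne (ae_of_all _ fun n => ?_)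
      simp_rw [lintegral_count]
      exact ENNReal.Tendsto.const_mul ((continuous_negExp.tendsto _).comp (hS ω n))
        (Or.inr (by by_cases hx : X n ω ∈ A <;> simp [hx]))
  have hrhs : Tendsto (fun k => ∫⁻ x in A, ENNReal.ofReal lam * negExp (ENNReal.ofReal lam *
        ∫⁻ z, (1 - negExp (coarsen U k g (cellLabel U k x) (cellLabel U k z))))) atTop
      (𝓝 (∫⁻ x in A, ENNReal.ofReal lam *
        negExp (ENNReal.ofReal lam * ∫⁻ z, (1 - negExp (g x z))))) := by
    refine tendsto_lintegral_of_dominated_convergence (fun _ => ENNReal.ofReal lam) (fun k => ?_)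
      (fun k => ae_of_all _ fun x => hle _ _) ?_ (ae_of_all _ fun x => ?_)
    · exact (measurable_of_finite fun a => ENNReal.ofReal lam * negExp (ENNReal.ofReal lam *
        ∫⁻ z, (1 - negExp (coarsen U k g a (cellLabel U k z))))).comp (hml k)
    · rw [setLIntegral_const]
      exact ENNReal.mul_ne_top ENNReal.ofReal_ne_top hA'.ne
    · refine ENNReal.Tendsto.const_mul ((continuous_negExp.tendsto _).comp
        (ENNReal.Tendsto.const_mul ?_ (Or.inr ENNReal.ofReal_ne_top)))
        (Or.inr ENNReal.ofReal_ne_top)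
      -- Over the whole plane there need be no integrable bound; the integrand increases with `k`
      -- instead.
      refine lintegral_tendsto_of_tendsto_of_monotone (fun k => ?_)
        (ae_of_all _ fun z k l hkl => ?_) (ae_of_all _ fun z => ?_)
      · exact ((measurable_of_finite fun b => 1 - negExp (coarsen U k g (cellLabel U k x) b)).comp
          (hml k)).aemeasurable
      · exact tsub_le_tsub_left (negExp_antitone (coarsen_monotone g _ _ hkl)) _
      · exact ENNReal.Tendsto.sub tendsto_const_nhds
          ((continuous_negExp.tendsto _).comp (tendsto_coarsen hg hb x z))
          (Or.inl ENNReal.one_ne_top)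
  refine tendsto_nhds_unique hlhs (hrhs.congr' ?_)
  filter_upwards [eventually_gt_atTop 0] with k hk
  exact (h.lintegral_tsum_coarsen hlam hA' hUA hU g k hk).symm

end IsPoissonPointProcess

/-! ### Rayleigh fading and the path-loss integral -/

/-- The integrand has an explicit primitive. The case `b = 1` yields the tail of the fading, the
case `y = 0`, `b = 1 + a` the Laplace transform of its square. -/
lemma lintegral_Ioi_rayleigh {σ b y : ℝ} (hσ : 0 < σ) (hb : 0 < b) (hy : 0 ≤ y) :
    ∫⁻ x in Set.Ioi y, ENNReal.ofReal (x / σ ^ 2 * Real.exp (-(b * x ^ 2 / (2 * σ ^ 2)))) =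
      ENNReal.ofReal (Real.exp (-(b * y ^ 2 / (2 * σ ^ 2))) / b) := by
  have hderiv : ∀ x ∈ Set.Ici y, HasDerivAt
      (fun x : ℝ => -(Real.exp (-(b * x ^ 2 / (2 * σ ^ 2))) / b))
      (x / σ ^ 2 * Real.exp (-(b * x ^ 2 / (2 * σ ^ 2)))) x := by
    intro x _
    have h1 : HasDerivAt (fun x : ℝ => -(b * x ^ 2 / (2 * σ ^ 2))) (-(b * (2 * x) / (2 * σ ^ 2))) x := by
      simpa using (((hasDerivAt_pow 2 x).const_mul b).div_const (2 * σ ^ 2)).fun_neg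
    convert! (h1.exp.div_const b).neg using 1
    field_simp
  have hpos : ∀ x ∈ Set.Ioi y, 0 ≤ x / σ ^ 2 * Real.exp (-(b * x ^ 2 / (2 * σ ^ 2))) := fun x hx => by
    have : 0 ≤ x := hy.trans (le_of_lt hx)
    positivity
  have hlim : Tendsto (fun x : ℝ => -(Real.exp (-(b * x ^ 2 / (2 * σ ^ 2))) / b)) atTop (𝓝 0) := by
    have h1 : Tendsto (fun x : ℝ => b * x ^ 2 / (2 * σ ^ 2)) atTop atTop :=
      ((tendsto_pow_atTop two_ne_zero).const_mul_atTop hb).atTop_div_const (by positivity)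
    simpa using ((Real.tendsto_exp_neg_atTop_nhds_zero.comp h1).div_const b).neg
  rw [← ofReal_integral_eq_lintegral_ofReal
      (integrableOn_Ioi_deriv_of_nonneg' hderiv hpos hlim)
      ((ae_restrict_iff' measurableSet_Ioi).2 (ae_of_all _ hpos)),
    integral_Ioi_of_hasDerivAt_of_nonneg' hderiv hpos hlim]
  simp

/-- The density vanishes at `0`, so the half-line may be open; the factor `1` is the `b` of
`lintegral_Ioi_rayleigh`. -/
lemma rayleighMeasure_eq (σ : ℝ) : rayleighMeasure σ =
    (volume.restrict (Set.Ioi 0)).withDensity fun x =>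
      ENNReal.ofReal (x / σ ^ 2 * Real.exp (-(1 * x ^ 2 / (2 * σ ^ 2)))) := by
  rw [← withDensity_indicator measurableSet_Ioi, rayleighMeasure]
  congr 1
  funext x
  by_cases hx : 0 < x
  · rw [Set.indicator_of_mem (by exact hx), if_pos hx.le, one_mul, neg_div]
  · rw [Set.indicator_of_notMem (by exact hx)]
    split_ifs with h
    · simp [le_antisymm (not_lt.1 hx) h]
    · simp

lemma measurable_rayleigh_density (σ : ℝ) : Measurable fun x : ℝ =>
    ENNReal.ofReal (x / σ ^ 2 * Real.exp (-(1 * x ^ 2 / (2 * σ ^ 2)))) := by fun_prop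

lemma rayleighMeasure_Ioi {σ y : ℝ} (hσ : 0 < σ) (hy : 0 ≤ y) :
    rayleighMeasure σ (Set.Ioi y) = ENNReal.ofReal (Real.exp (-(y ^ 2 / (2 * σ ^ 2)))) := by
  rw [rayleighMeasure_eq, withDensity_apply _ measurableSet_Ioi, Measure.restrict_restrict
    measurableSet_Ioi, Set.inter_eq_left.2 (Set.Ioi_subset_Ioi hy),
    lintegral_Ioi_rayleigh hσ one_pos hy]
  simp

/-- The probability that Rayleigh fading `x` satisfies `a < b x ^ 2`. -/
lemma rayleighMeasure_lt_mul_sq {σ : ℝ} (hσ : 0 < σ) {b : ℝ} (hb : 0 < b) (a : ℝ≥0∞) :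
    rayleighMeasure σ {x | a < ENNReal.ofReal b * ENNReal.ofReal x ^ 2} =
      negExp (ENNReal.ofReal (1 / (b * (2 * σ ^ 2))) * a) := by
  induction a with
  | top => simp [hσ, hb]
  | coe a =>
    have h : {x : ℝ | (a : ℝ≥0∞) < ENNReal.ofReal b * ENNReal.ofReal x ^ 2} =
        Set.Ioi (√(a / b)) := by
      ext x
      rw [Set.mem_ofPred_eq, Set.mem_Ioi]
      rcases le_or_gt x 0 with hx | hx
      · simpa [ENNReal.ofReal_of_nonpos hx] using hx.trans (Real.sqrt_nonneg (a / b))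
      · rw [← ENNReal.ofReal_coe_nnreal, ← ENNReal.ofReal_pow hx.le, ← ENNReal.ofReal_mul hb.le,
          ENNReal.ofReal_lt_ofReal_iff (by positivity), Real.sqrt_lt' hx, div_lt_iff₀ hb, mul_comm]
    rw [h, rayleighMeasure_Ioi hσ (Real.sqrt_nonneg _), Real.sq_sqrt (by positivity),
      ← negExp_ofReal (by positivity), ← ENNReal.ofReal_coe_nnreal,
      ← ENNReal.ofReal_mul (by positivity)]
    congr 2
    field_simp

/-- The Laplace transform of the squared Rayleigh fading. -/
lemma lintegral_negExp_sq_rayleighMeasure {σ : ℝ} (hσ : 0 < σ) (a : ℝ≥0∞) :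
    ∫⁻ x, negExp (ENNReal.ofReal (1 / (2 * σ ^ 2)) * a * ENNReal.ofReal x ^ 2) ∂rayleighMeasure σ =
      (1 + a)⁻¹ := by
  have hm : ∀ a : ℝ≥0∞, Measurable fun x : ℝ =>
      negExp (ENNReal.ofReal (1 / (2 * σ ^ 2)) * a * ENNReal.ofReal x ^ 2) := fun a =>
    measurable_negExp.comp (by fun_prop)
  rw [rayleighMeasure_eq, lintegral_withDensity_eq_lintegral_mul _ (measurable_rayleigh_density σ)
    (hm a)]
  induction a with
  -- This value occurs for an interferer located exactly at the receiver.
  | top =>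
    rw [setLIntegral_congr_fun measurableSet_Ioi (g := fun _ => 0)]
    · simp
    · intro x hx
      have hx' : (0 : ℝ) < x := hx
      have : ENNReal.ofReal (1 / (2 * σ ^ 2)) * ∞ * ENNReal.ofReal x ^ 2 = ∞ := by
        rw [ENNReal.mul_top (by simpa using by positivity), ENNReal.top_mul (by simpa using hx')]
      rw [Pi.mul_apply, this, negExp_top, mul_zero]
  | coe a =>
    have e : ∀ x ∈ Set.Ioi (0 : ℝ), ((fun x => ENNReal.ofReal (x / σ ^ 2 * Real.exp (-(1 * x ^ 2 / (2 * σ ^ 2))))) *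
        fun x => negExp (ENNReal.ofReal (1 / (2 * σ ^ 2)) * a * ENNReal.ofReal x ^ 2)) x =
        ENNReal.ofReal (x / σ ^ 2 * Real.exp (-((1 + a) * x ^ 2 / (2 * σ ^ 2)))) := by
      intro x hx
      have hx' : (0 : ℝ) < x := hx
      rw [Pi.mul_apply, ← ENNReal.ofReal_coe_nnreal, ← ENNReal.ofReal_mul (by positivity),
        ← ENNReal.ofReal_pow hx'.le, ← ENNReal.ofReal_mul (by positivity),
        negExp_ofReal (by positivity), ← ENNReal.ofReal_mul (by positivity), mul_assoc,
        ← Real.exp_add]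
      congr 4
      field_simp
      ring
    rw [setLIntegral_congr_fun measurableSet_Ioi e,
      lintegral_Ioi_rayleigh hσ (by positivity) le_rfl]
    rw [ENNReal.ofReal_div_of_pos (by positivity), ENNReal.ofReal_add zero_le_one a.coe_nonneg]
    simp

lemma lintegral_rpow_mul_exp_neg_mul_rpow {p q b : ℝ} (hp : 0 < p) (hq : -1 < q) (hb : 0 < b) :
    ∫⁻ x in Set.Ioi (0 : ℝ), ENNReal.ofReal (x ^ q * Real.exp (-b * x ^ p)) =
      ENNReal.ofReal (b ^ (-(q + 1) / p) * (1 / p) * Real.Gamma ((q + 1) / p)) := by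
  rw [← integral_rpow_mul_exp_neg_mul_rpow hp hq hb, ofReal_integral_eq_lintegral_ofReal]
  · exact integrableOn_rpow_mul_exp_neg_mul_rpow hq hp hb
  · refine (ae_restrict_iff' measurableSet_Ioi).2 (ae_of_all _ fun x hx => ?_)
    have : (0 : ℝ) < x := hx
    simp only [Pi.zero_apply]
    positivity

/-- Write `1 / (r^α + c)` as `∫ exp (-x (r^α + c)) dx` and exchange the integrals. Both become Gamma
integrals, and the reflection formula evaluates `Γ(2/α) Γ(1 - 2/α)`. The condition `α > 2` is what
makes the second integral converge. -/
lemma lintegral_mul_div_rpow_add {α c : ℝ} (hα : 2 < α) (hc : 0 < c) :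
    ∫⁻ r in Set.Ioi (0 : ℝ), ENNReal.ofReal (r * (c / (r ^ α + c))) =
      ENNReal.ofReal (c ^ (2 / α) * (Real.pi / (α * Real.sin (2 * Real.pi / α)))) := by
  have hα0 : 0 < α := by linarith
  have h2α : 2 / α < 1 := by rw [div_lt_one hα0]; exact hα
  have h1 : ∀ r ∈ Set.Ioi (0 : ℝ), ENNReal.ofReal (r * (c / (r ^ α + c))) =
      ∫⁻ x in Set.Ioi (0 : ℝ), ENNReal.ofReal (c * r * Real.exp (-(x * (r ^ α + c)))) := by
    intro r hr
    have hr' : (0 : ℝ) < r := hr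
    have hb : 0 < r ^ α + c := by positivity
    have := lintegral_rpow_mul_exp_neg_mul_rpow one_pos (q := 0) (by norm_num) hb
    simp only [Real.rpow_zero, Real.rpow_one, one_mul] at this
    have e : ∀ x : ℝ, ENNReal.ofReal (c * r * Real.exp (-(x * (r ^ α + c)))) =
        ENNReal.ofReal (c * r) * ENNReal.ofReal (Real.exp (-(r ^ α + c) * x)) := fun x => by
      rw [← ENNReal.ofReal_mul (by positivity)]; ring_nf
    simp_rw [e]
    rw [lintegral_const_mul _ (by fun_prop), this, ← ENNReal.ofReal_mul (by positivity)]
    congr 1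
    norm_num [Real.rpow_neg_one]
    ring
  have h2 : ∀ x ∈ Set.Ioi (0 : ℝ),
      ∫⁻ r in Set.Ioi (0 : ℝ), ENNReal.ofReal (c * r * Real.exp (-(x * (r ^ α + c)))) =
      ENNReal.ofReal (c / α * Real.Gamma (2 / α)) *
        ENNReal.ofReal (x ^ (-(2 / α)) * Real.exp (-c * x ^ (1 : ℝ))) := by
    intro x hx
    have hx' : (0 : ℝ) < x := hx
    have := lintegral_rpow_mul_exp_neg_mul_rpow hα0 (q := 1) (by norm_num) hx'
    have e : ∀ r : ℝ, ENNReal.ofReal (c * r * Real.exp (-(x * (r ^ α + c)))) =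
        ENNReal.ofReal (c * Real.exp (-c * x)) *
          ENNReal.ofReal (r ^ (1 : ℝ) * Real.exp (-x * r ^ α)) := fun r => by
      rw [← ENNReal.ofReal_mul (by positivity), Real.rpow_one,
        show -(x * (r ^ α + c)) = -c * x + -x * r ^ α by ring, Real.exp_add]
      ring_nf
    have hG := Real.Gamma_pos_of_pos (show 0 < 2 / α by positivity)
    simp_rw [e]
    rw [lintegral_const_mul _ (by fun_prop), this, ← ENNReal.ofReal_mul (by positivity),
      ← ENNReal.ofReal_mul (by positivity)]
    congr 1
    rw [Real.rpow_one, show -(1 + 1) / α = -(2 / α) by ring, show ((1 : ℝ) + 1) / α = 2 / α by ring]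
    ring
  rw [setLIntegral_congr_fun measurableSet_Ioi h1, lintegral_lintegral_swap,
    setLIntegral_congr_fun measurableSet_Ioi h2, lintegral_const_mul _ (by fun_prop),
    lintegral_rpow_mul_exp_neg_mul_rpow one_pos (by linarith) hc]
  · have hG := Real.Gamma_pos_of_pos (show 0 < 2 / α by positivity)
    rw [← ENNReal.ofReal_mul (by positivity)]
    congr 1
    have hrefl := Real.Gamma_mul_Gamma_one_sub (2 / α)
    rw [show Real.pi * (2 / α) = 2 * Real.pi / α by ring] at hrefl
    rw [show -(-(2 / α) + 1) / 1 = 2 / α + (-1) by ring, show (-(2 / α) + 1) / 1 = 1 - 2 / α by ring,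
      Real.rpow_add hc, Real.rpow_neg_one]
    calc _ = c ^ (2 / α) / α * (Real.Gamma (2 / α) * Real.Gamma (1 - 2 / α)) := by
            field_simp
      _ = _ := by rw [hrefl]; field_simp
  · refine Measurable.aemeasurable ?_
    simp only [Function.uncurry_def]
    fun_prop

/-- Integral over the plane of the probability that an interferer at a given place, which
transmits, prevents the reception. -/
lemma lintegral_plane_path_loss {α c : ℝ} (hα : 2 < α) (hc : 0 < c) :
    ∫⁻ z : Plane, (1 - (1 + ENNReal.ofReal c * ‖z‖ₑ ^ (-α))⁻¹) =
      ENNReal.ofReal (c ^ (2 / α) * pathLossConst α) := by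
  have hα0 : 0 < α := by linarith
  have hrad := lintegral_mul_div_rpow_add hα hc
  have hpos : ∀ r ∈ Set.Ioi (0 : ℝ), 0 ≤ r * (c / (r ^ α + c)) := fun r hr => by
    have : (0 : ℝ) < r := hr
    positivity
  have hpos' : 0 ≤ᵐ[volume.restrict (Set.Ioi (0 : ℝ))] fun r => r * (c / (r ^ α + c)) :=
    (ae_restrict_iff' measurableSet_Ioi).2 (ae_of_all _ hpos)
  have hmeas : Measurable fun r : ℝ => r * (c / (r ^ α + c)) := by fun_prop
  have hint : IntegrableOn (fun r : ℝ => r * (c / (r ^ α + c))) (Set.Ioi 0) := by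
    refine ⟨hmeas.aestronglyMeasurable, ?_⟩
    rw [hasFiniteIntegral_iff_ofReal hpos', hrad]
    exact ENNReal.ofReal_lt_top
  have hsin : 0 < Real.sin (2 * Real.pi / α) := by
    refine Real.sin_pos_of_pos_of_lt_pi (by positivity) ?_
    rw [div_lt_iff₀ hα0]
    nlinarith [Real.pi_pos]
  have hreal : ∫ r in Set.Ioi (0 : ℝ), r * (c / (r ^ α + c)) =
      c ^ (2 / α) * (Real.pi / (α * Real.sin (2 * Real.pi / α))) := by
    rw [integral_eq_lintegral_of_nonneg_ae hpos' hmeas.aestronglyMeasurable, hrad,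
      ENNReal.toReal_ofReal (by positivity)]
  have hdim : Module.finrank ℝ Plane = 2 := by simp
  have hplane : ∫ z : Plane, c / (‖z‖ ^ α + c) = c ^ (2 / α) * pathLossConst α := by
    -- Polar coordinates: the dimension times the area of the unit disc is the factor `2π`.
    rw [integral_fun_norm_addHaar volume fun r : ℝ => c / (r ^ α + c), hdim]
    simp only [Nat.add_one_sub_one, pow_one, smul_eq_mul, hreal, nsmul_eq_mul]
    rw [measureReal_def, EuclideanSpace.volume_ball_fin_two, pathLossConst]
    simp [Real.pi_pos.le]
    field_simp
  have hintp : Integrable fun z : Plane => c / (‖z‖ ^ α + c) := by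
    rw [integrable_fun_norm_addHaar volume (f := fun r : ℝ => c / (r ^ α + c)), hdim]
    simpa using hint
  rw [← hplane, ofReal_integral_eq_lintegral_ofReal hintp (ae_of_all _ fun z => by
    simp only [Pi.zero_apply]; positivity)]
  refine lintegral_congr_ae ?_
  filter_upwards [compl_mem_ae_iff.2 (measure_singleton (0 : Plane))] with z hz
  have hz' : 0 < ‖z‖ := norm_pos_iff.2 hz
  rw [← ofReal_norm, ENNReal.ofReal_rpow_of_pos hz', ← ENNReal.ofReal_mul hc.le,
    ← ENNReal.ofReal_one, ← ENNReal.ofReal_add zero_le_one (by positivity),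
    ← ENNReal.ofReal_inv_of_pos (by positivity), ← ENNReal.ofReal_sub _ (by positivity)]
  congr 1
  rw [Real.rpow_neg hz'.le]
  field_simp
  ring

/-! ### Independence of the sources of randomness -/

/-- If a family of σ-algebras splits into independent groups, and is independent within each group,
then it is independent. -/
lemma iIndep_of_groups {Ω ι κ : Type*} [Fintype κ] {mΩ : MeasurableSpace Ω} {P : Measure Ω}
    {m : ι → MeasurableSpace Ω} {G : κ → MeasurableSpace Ω} (kind : ι → κ) (hG : iIndep G P)
    (hle : ∀ i, m i ≤ G (kind i)) (hin : ∀ k, iIndep (fun i : {i // kind i = k} => m i) P) :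
    iIndep m P := by
  classical
  rw [iIndep_iff]
  intro S f hf
  have h1 : ⋂ i ∈ S, f i = ⋂ k ∈ (Finset.univ : Finset κ), ⋂ i ∈ S.subtype (kind · = k), f i := by
    ext ω
    simp only [Set.mem_iInter, Finset.mem_univ, true_implies, Finset.mem_subtype, Subtype.forall]
    exact ⟨fun h k i _ hi => h i hi, fun h i hi => h _ i rfl hi⟩
  rw [h1, hG.meas_biInter]
  · rw [← Finset.prod_fiberwise S kind]
    refine Finset.prod_congr rfl fun k _ => ?_
    rw [(hin k).meas_biInter fun i hi => hf i (Finset.mem_subtype.1 hi)]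
    rw [← Finset.prod_subtype_eq_prod_filter]
  · intro k _
    refine Finset.measurableSet_biInter _ fun i hi => ?_
    have := hle i
    rw [i.2] at this
    exact this _ (hf i (Finset.mem_subtype.1 hi))

/-- Expectation of a function of independent `L` and `Z`: average over `Z` with `L` frozen. -/
lemma lintegral_of_indep {Ω β γ : Type*} {m₁ m₂ mΩ : MeasurableSpace Ω} [MeasurableSpace β]
    [MeasurableSpace γ] {P : Measure Ω} [IsProbabilityMeasure P]
    (h₁ : m₁ ≤ mΩ) (h₂ : m₂ ≤ mΩ) (h : Indep m₁ m₂ P) {L : Ω → β} {Z : Ω → γ}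
    (hL : Measurable[m₁] L) (hZ : Measurable[m₂] Z) {φ : β → γ → ℝ≥0∞}
    (hφ : Measurable (Function.uncurry φ)) :
    ∫⁻ ω, φ (L ω) (Z ω) ∂P = ∫⁻ ω, ∫⁻ ω', φ (L ω) (Z ω') ∂P ∂P := by
  have hL' : Measurable L := hL.mono h₁ le_rfl
  have hZ' : Measurable Z := hZ.mono h₂ le_rfl
  have hi : IndepFun L Z P :=
    indep_of_indep_of_le_left (indep_of_indep_of_le_right h hZ.comap_le) hL.comap_le
  have h1 := lintegral_map (μ := P) hφ (hL'.prodMk hZ')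
  rw [hi.map_prod_eq_prod_map_map hL'.aemeasurable hZ'.aemeasurable] at h1
  have : IsProbabilityMeasure (P.map Z) := Measure.isProbabilityMeasure_map hZ'.aemeasurable
  rw [lintegral_prod _ hφ.aemeasurable, lintegral_map (hφ.lintegral_prod_right') hL'] at h1
  simp only [Function.uncurry_apply_pair] at h1
  rw [← h1]
  refine lintegral_congr fun ω => ?_
  exact lintegral_map (hφ.comp measurable_prodMk_left) hZ'

namespace HarvestingNetwork

/-- The independent sources of randomness of the network. -/
inductive Source
  | loc
  | dir
  | fade (m s : ℕ)
  | init (m : ℕ)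
  | arrival (m t : ℕ)
  | coin (m t : ℕ)

/-- The kind of a source of randomness. -/
def Source.kind : Source → Fin 6
  | .loc => 0
  | .dir => 1
  | .fade _ _ => 2
  | .init _ => 3
  | .arrival _ _ => 4
  | .coin _ _ => 5

lemma Source.eq_loc {i : Source} (h : i.kind = 0) : i = .loc := by
  cases i <;> simp [kind] at h ⊢

lemma Source.eq_dir {i : Source} (h : i.kind = 1) : i = .dir := by
  cases i <;> simp [kind] at h ⊢

lemma Source.exists_fade {i : Source} (h : i.kind = 2) : ∃ m s, i = .fade m s := by
  cases i <;> simp [kind] at h ⊢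

lemma Source.exists_init {i : Source} (h : i.kind = 3) : ∃ m, i = .init m := by
  cases i <;> simp [kind] at h ⊢

lemma Source.exists_arrival {i : Source} (h : i.kind = 4) : ∃ m t, i = .arrival m t := by
  cases i <;> simp [kind] at h ⊢

lemma Source.exists_coin {i : Source} (h : i.kind = 5) : ∃ m t, i = .coin m t := by
  cases i <;> simp [kind] at h ⊢

variable {Ω : Type*} [MeasurableSpace Ω] {P : Measure Ω} {lam p σ : ℝ}

/-- The σ-algebra of a source of randomness. -/
@[reducible]
noncomputable def sourceAlgebra (N : HarvestingNetwork P lam p σ) : Source → MeasurableSpace Ω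
  | .loc => generated N.loc
  | .dir => generated N.dir
  | .fade m s => MeasurableSpace.comap (N.fade m s) inferInstance
  | .init m => MeasurableSpace.comap (N.init m) inferInstance
  | .arrival m t => MeasurableSpace.comap (N.arrival m t) inferInstance
  | .coin m t => MeasurableSpace.comap (N.coin m t) inferInstance

/-- The σ-algebra generated by the sources in `S`. -/
@[reducible]
noncomputable def known (N : HarvestingNetwork P lam p σ) (S : Set Source) : MeasurableSpace Ω :=
  ⨆ i ∈ S, N.sourceAlgebra i

variable (N : HarvestingNetwork P lam p σ)

lemma sourceAlgebra_le (i : Source) : N.sourceAlgebra i ≤ ‹MeasurableSpace Ω› := by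
  cases i with
  | loc => exact iSup_le fun m => (N.loc_poisson.measurable m).comap_le
  | dir => exact iSup_le fun m => (N.dir_measurable m).comap_le
  | fade m s => exact (N.fade_measurable m s).comap_le
  | init m => exact (N.init_measurable m).comap_le
  | arrival m t => exact (N.arrival_measurable m t).comap_le
  | coin m t => exact (N.coin_measurable m t).comap_le

lemma known_le (S : Set Source) : N.known S ≤ ‹MeasurableSpace Ω› :=
  iSup₂_le fun i _ => N.sourceAlgebra_le i

lemma known_mono {S T : Set Source} (h : S ⊆ T) : N.known S ≤ N.known T :=
  biSup_mono h

lemma sourceAlgebra_le_known {S : Set Source} {i : Source} (h : i ∈ S) :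
    N.sourceAlgebra i ≤ N.known S :=
  le_iSup₂_of_le i h le_rfl

/-- The kinds are independent of each other, and so are the members of each of the last four kinds.
Locations form one source and orientations another, because no independence between different
transmitters is assumed for them. -/
lemma iIndep_sourceAlgebra [IsProbabilityMeasure P] : iIndep N.sourceAlgebra P := by
  refine iIndep_of_groups Source.kind N.indep (fun i => ?_) fun k => ?_
  · cases i with
    | loc => exact le_rfl
    | dir => exact le_rfl
    | fade m s => exact le_iSup_of_le (m, s) le_rfl
    | init m => exact le_iSup_of_le m le_rfl
    | arrival m t => exact le_iSup_of_le (m, t) le_rfl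
    | coin m t => exact le_iSup_of_le (m, t) le_rfl
  · fin_cases k
    · have : Subsingleton {i : Source // i.kind = 0} :=
        ⟨fun i j => Subtype.ext ((Source.eq_loc i.2).trans (Source.eq_loc j.2).symm)⟩
      exact iIndep.of_subsingleton (ι := {i : Source // i.kind = 0})
    · have : Subsingleton {i : Source // i.kind = 1} :=
        ⟨fun i j => Subtype.ext ((Source.eq_dir i.2).trans (Source.eq_dir j.2).symm)⟩
      exact iIndep.of_subsingleton (ι := {i : Source // i.kind = 1})
    · refine iIndep.of_precomp
        (g := fun i : ℕ × ℕ => (⟨.fade i.1 i.2, rfl⟩ : {i : Source // i.kind = 2}))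
        (fun i => ?_) ((iIndepFun_iff_iIndep ..).1 N.fade_indep)
      obtain ⟨m, s, h⟩ := Source.exists_fade i.2
      exact ⟨(m, s), Subtype.ext h.symm⟩
    · refine iIndep.of_precomp (g := fun i : ℕ => (⟨.init i, rfl⟩ : {i : Source // i.kind = 3}))
        (fun i => ?_) ((iIndepFun_iff_iIndep ..).1 N.init_indep)
      obtain ⟨m, h⟩ := Source.exists_init i.2
      exact ⟨m, Subtype.ext h.symm⟩
    · refine iIndep.of_precomp
        (g := fun i : ℕ × ℕ => (⟨.arrival i.1 i.2, rfl⟩ : {i : Source // i.kind = 4}))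
        (fun i => ?_) ((iIndepFun_iff_iIndep ..).1 N.arrival_indep)
      obtain ⟨m, s, h⟩ := Source.exists_arrival i.2
      exact ⟨(m, s), Subtype.ext h.symm⟩
    · refine iIndep.of_precomp
        (g := fun i : ℕ × ℕ => (⟨.coin i.1 i.2, rfl⟩ : {i : Source // i.kind = 5}))
        (fun i => ?_) ((iIndepFun_iff_iIndep ..).1 N.coin_indep)
      obtain ⟨m, s, h⟩ := Source.exists_coin i.2
      exact ⟨(m, s), Subtype.ext h.symm⟩

/-- Reduces every later use of independence to the disjointness of two sets of sources. -/
lemma indep_known [IsProbabilityMeasure P] {S T : Set Source} (h : Disjoint S T) :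
    Indep (N.known S) (N.known T) P :=
  indep_iSup_of_disjoint N.sourceAlgebra_le N.iIndep_sourceAlgebra h

lemma lintegral_of_disjoint [IsProbabilityMeasure P] {S T : Set Source} (h : Disjoint S T)
    {β γ : Type*} [MeasurableSpace β] [MeasurableSpace γ] {L : Ω → β} {Z : Ω → γ}
    (hL : Measurable[N.known S] L) (hZ : Measurable[N.known T] Z) {φ : β → γ → ℝ≥0∞}
    (hφ : Measurable (Function.uncurry φ)) :
    ∫⁻ ω, φ (L ω) (Z ω) ∂P = ∫⁻ ω, ∫⁻ ω', φ (L ω) (Z ω') ∂P ∂P :=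
  lintegral_of_indep (N.known_le S) (N.known_le T) (N.indep_known h) hL hZ hφ

lemma measurable_loc {S : Set Source} (h : Source.loc ∈ S) (m : ℕ) :
    Measurable[N.known S] (N.loc m) :=
  measurable_iff_comap_le.2 ((le_iSup (fun i => MeasurableSpace.comap (N.loc i) _) m).trans
    (N.sourceAlgebra_le_known h))

lemma measurable_dir {S : Set Source} (h : Source.dir ∈ S) (m : ℕ) :
    Measurable[N.known S] (N.dir m) :=
  measurable_iff_comap_le.2 ((le_iSup (fun i => MeasurableSpace.comap (N.dir i) _) m).trans
    (N.sourceAlgebra_le_known h))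

lemma measurable_fade {S : Set Source} {m s : ℕ} (h : Source.fade m s ∈ S) :
    Measurable[N.known S] (N.fade m s) :=
  measurable_iff_comap_le.2 (N.sourceAlgebra_le_known h)

lemma measurable_init {S : Set Source} {m : ℕ} (h : Source.init m ∈ S) :
    Measurable[N.known S] (N.init m) :=
  measurable_iff_comap_le.2 (N.sourceAlgebra_le_known h)

lemma measurable_arrival {S : Set Source} {m t : ℕ} (h : Source.arrival m t ∈ S) :
    Measurable[N.known S] (N.arrival m t) :=
  measurable_iff_comap_le.2 (N.sourceAlgebra_le_known h)

lemma measurable_coin {S : Set Source} {m t : ℕ} (h : Source.coin m t ∈ S) :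
    Measurable[N.known S] (N.coin m t) :=
  measurable_iff_comap_le.2 (N.sourceAlgebra_le_known h)

end HarvestingNetwork

/-! ### Law of the energy of a transmitter -/

namespace HarvestingNetwork

variable {Ω : Type*} [MeasurableSpace Ω] {P : Measure Ω} {lam p σ : ℝ}
  (N : HarvestingNetwork P lam p σ)

/-- The sources that determine the energy of the transmitter `m` at time `t`. -/
def energySources (m t : ℕ) : Set Source :=
  {i | i = .init m ∨ ∃ s < t, i = .arrival m s ∨ i = .coin m s}

lemma energySources_mono (m : ℕ) : Monotone (energySources m) := by
  rintro a b hab i (h | ⟨s, hs, h⟩)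
  · exact Or.inl h
  · exact Or.inr ⟨s, hs.trans_le hab, h⟩

lemma measurable_energy_update (q : ℝ) : Measurable fun x : ℕ × ℕ × ℝ =>
    x.1 + x.2.1 - if 1 ≤ x.1 ∧ x.2.2 < q then 1 else 0 := by
  refine (measurable_fst.add measurable_snd.fst).sub
    (Measurable.ite (MeasurableSet.inter ?_ ?_) measurable_const measurable_const)
  · exact measurableSet_le measurable_const measurable_fst
  · exact measurableSet_lt measurable_snd.snd measurable_const

lemma measurable_energy (q : ℝ) (m t : ℕ) :
    Measurable[N.known (energySources m t)] (N.energy q m t) := by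
  induction t with
  | zero => exact N.measurable_init (Or.inl rfl)
  | succ t ih =>
    have h1 : Measurable[N.known (energySources m (t + 1))] (N.energy q m t) :=
      ih.mono (N.known_mono (energySources_mono m (Nat.le_succ t))) le_rfl
    have h2 : Measurable[N.known (energySources m (t + 1))] (N.arrival m t) :=
      N.measurable_arrival (Or.inr ⟨t, Nat.lt_succ_self t, Or.inl rfl⟩)
    have h3 : Measurable[N.known (energySources m (t + 1))] (N.coin m t) :=
      N.measurable_coin (Or.inr ⟨t, Nat.lt_succ_self t, Or.inr rfl⟩)
    exact (measurable_energy_update q).comp (h1.prodMk (h2.prodMk h3))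

lemma lintegral_comp_arrival [IsProbabilityMeasure P] (hp : 0 ≤ p) (hp1 : p ≤ 1) (m t : ℕ)
    (f : ℕ → ℝ≥0∞) :
    ∫⁻ ω, f (N.arrival m t ω) ∂P = ENNReal.ofReal (1 - p) * f 0 + ENNReal.ofReal p * f 1 := by
  have h0 : MeasurableSet {ω | N.arrival m t ω = 0} :=
    N.arrival_measurable m t (measurableSet_singleton 0)
  have h1 : MeasurableSet {ω | N.arrival m t ω = 1} :=
    N.arrival_measurable m t (measurableSet_singleton 1)
  have hd : Disjoint {ω | N.arrival m t ω = 0} {ω | N.arrival m t ω = 1} :=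
    Set.disjoint_left.2 fun ω ha hb => by simp_all
  have hae : ∀ᵐ ω ∂P, N.arrival m t ω = 0 ∨ N.arrival m t ω = 1 := by
    refine (prob_compl_eq_zero_iff (h0.union h1)).2 ?_
    rw [measure_union hd h1, N.arrival_zero, N.arrival_one,
      ← ENNReal.ofReal_add (by linarith) hp]
    simp
  have e : ∫⁻ ω, f (N.arrival m t ω) ∂P = ∫⁻ ω, ({ω | N.arrival m t ω = 0}.indicator (fun _ => f 0) ω +
      {ω | N.arrival m t ω = 1}.indicator (fun _ => f 1) ω) ∂P := by
    refine lintegral_congr_ae ?_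
    filter_upwards [hae] with ω hω
    rcases hω with h | h <;> simp [h]
  rw [e, lintegral_add_left (measurable_const.indicator h0), lintegral_indicator_const h0,
    lintegral_indicator_const h1, N.arrival_zero, N.arrival_one, mul_comm, mul_comm (f 1)]

lemma measure_coin_lt {q : ℝ} (hq1 : q ≤ 1) (m t : ℕ) :
    P {ω | N.coin m t ω < q} = ENNReal.ofReal q := by
  have : {ω | N.coin m t ω < q} = N.coin m t ⁻¹' Set.Iio q := rfl
  rw [this, ← Measure.map_apply (N.coin_measurable m t) measurableSet_Iio, N.coin_law,
    Measure.restrict_apply measurableSet_Iio]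
  have : Set.Iio q ∩ Set.Icc 0 1 = Set.Ico 0 q := by
    ext x
    simp only [Set.mem_inter_iff, Set.mem_Iio, Set.mem_Icc, Set.mem_Ico]
    exact ⟨fun h => ⟨h.2.1, h.1⟩, fun h => ⟨h.2, h.1, h.2.le.trans hq1⟩⟩
  rw [this, Real.volume_Ico, sub_zero]

lemma lintegral_comp_coin [IsProbabilityMeasure P] {q : ℝ} (hq : 0 ≤ q) (hq1 : q ≤ 1) (m t : ℕ)
    (a b : ℝ≥0∞) : ∫⁻ ω, (if N.coin m t ω < q then a else b) ∂P =
      ENNReal.ofReal q * a + ENNReal.ofReal (1 - q) * b := by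
  have h : MeasurableSet {ω | N.coin m t ω < q} :=
    measurableSet_lt (N.coin_measurable m t) measurable_const
  have e : ∀ ω, (if N.coin m t ω < q then a else b) = {ω | N.coin m t ω < q}.indicator (fun _ => a) ω +
      {ω | N.coin m t ω < q}ᶜ.indicator (fun _ => b) ω := fun ω => by
    by_cases hω : N.coin m t ω < q <;> simp [hω]
  simp_rw [e]
  rw [lintegral_add_left (measurable_const.indicator h), lintegral_indicator_const h,
    lintegral_indicator_const h.compl, prob_compl_eq_one_sub h, N.measure_coin_lt hq1,
    ← ENNReal.ofReal_one, ← ENNReal.ofReal_sub _ hq, mul_comm, mul_comm b]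

lemma lintegral_energy_step [IsProbabilityMeasure P] (hp : 0 ≤ p) (hp1 : p ≤ 1) {q : ℝ}
    (hq : 0 ≤ q) (hq1 : q ≤ 1) (m t e : ℕ) {f : ℕ → ℝ} (hf : ∀ e, 0 ≤ f e) :
    ∫⁻ ω, ENNReal.ofReal (f (e + N.arrival m t ω -
        if 1 ≤ e ∧ N.coin m t ω < q then 1 else 0)) ∂P =
      ENNReal.ofReal (batteryStep p q f e) := by
  have hp' : 0 ≤ 1 - p := by linarith
  have hq' : 0 ≤ 1 - q := by linarith
  have hdisj : Disjoint ({.coin m t} : Set Source) {.arrival m t} := by simp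
  have hL := N.measurable_coin (S := {Source.coin m t}) rfl
  have hZ := N.measurable_arrival (S := {Source.arrival m t}) rfl
  have hm : Measurable (Function.uncurry fun (c : ℝ) (a : ℕ) =>
      ENNReal.ofReal (f (e + a - if 1 ≤ e ∧ c < q then 1 else 0))) := by
    exact (measurable_from_top (f := fun k => ENNReal.ofReal (f k))).comp
      ((measurable_energy_update q).comp
        (measurable_const.prodMk (measurable_snd.prodMk measurable_fst)))
  rw [N.lintegral_of_disjoint hdisj hL hZ hm]
  simp_rw [fun ω => N.lintegral_comp_arrival hp hp1 m t
    fun a => ENNReal.ofReal (f (e + a - if 1 ≤ e ∧ N.coin m t ω < q then 1 else 0))]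
  rcases Nat.eq_zero_or_pos e with rfl | he
  · simp only [batteryStep, if_true]
    rw [ENNReal.ofReal_add (mul_nonneg hp' (hf _)) (mul_nonneg hp (hf _)),
      ENNReal.ofReal_mul hp', ENNReal.ofReal_mul hp]
    simp
  · have he1 : 1 ≤ e := he
    have h1 : ∀ ω, ENNReal.ofReal (1 - p) * ENNReal.ofReal (f (e + 0 - if 1 ≤ e ∧ N.coin m t ω < q then 1 else 0)) +
        ENNReal.ofReal p * ENNReal.ofReal (f (e + 1 - if 1 ≤ e ∧ N.coin m t ω < q then 1 else 0)) =
        if N.coin m t ω < q then ENNReal.ofReal ((1 - p) * f (e - 1) + p * f e)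
          else ENNReal.ofReal ((1 - p) * f e + p * f (e + 1)) := by
      intro ω
      rw [← ENNReal.ofReal_mul hp', ← ENNReal.ofReal_mul hp,
        ← ENNReal.ofReal_add (mul_nonneg hp' (hf _)) (mul_nonneg hp (hf _))]
      split_ifs <;> simp_all
    simp_rw [h1]
    have h2 : 0 ≤ (1 - p) * f (e - 1) + p * f e :=
      add_nonneg (mul_nonneg hp' (hf _)) (mul_nonneg hp (hf _))
    have h3 : 0 ≤ (1 - p) * f e + p * f (e + 1) :=
      add_nonneg (mul_nonneg hp' (hf _)) (mul_nonneg hp (hf _))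
    rw [N.lintegral_comp_coin hq hq1, ← ENNReal.ofReal_mul hq, ← ENNReal.ofReal_mul hq',
      ← ENNReal.ofReal_add (mul_nonneg hq h2) (mul_nonneg hq' h3)]
    congr 1
    rw [batteryStep, if_neg he.ne']
    ring

/-- The Markov property. The energy at time `t` and the arrival and coin of slot `t` have disjoint
sources, so the last slot can be averaged with the energy frozen; this replaces `f` by `batteryStep
p q f`, for which the induction hypothesis is used. -/
lemma lintegral_comp_energy [IsProbabilityMeasure P] (hp : 0 ≤ p) (hp1 : p ≤ 1) {q : ℝ}
    (hq : 0 ≤ q) (hq1 : q ≤ 1) (m t : ℕ) {f : ℕ → ℝ} (hf : ∀ e, 0 ≤ f e) :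
    ∫⁻ ω, ENNReal.ofReal (f (N.energy q m t ω)) ∂P =
      ∫⁻ ω, ENNReal.ofReal ((batteryStep p q)^[t] f (N.init m ω)) ∂P := by
  induction t generalizing f with
  | zero => rfl
  | succ t ih =>
    have hdisj : Disjoint (energySources m t) {Source.arrival m t, Source.coin m t} := by
      refine Set.disjoint_left.2 ?_
      rintro i (rfl | ⟨s, hs, rfl | rfl⟩) (h | h) <;> simp_all
    have hZ : Measurable[N.known {Source.arrival m t, Source.coin m t}]
        fun ω => (N.arrival m t ω, N.coin m t ω) :=
      (N.measurable_arrival (by simp)).prodMk (N.measurable_coin (by simp))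
    have hφ : Measurable (Function.uncurry fun (e : ℕ) (z : ℕ × ℝ) =>
        ENNReal.ofReal (f (e + z.1 - if 1 ≤ e ∧ z.2 < q then 1 else 0))) := by
      exact (measurable_from_top (f := fun k => ENNReal.ofReal (f k))).comp
        (measurable_energy_update q)
    have h := N.lintegral_of_disjoint hdisj (N.measurable_energy q m t) hZ hφ
    simp only [N.lintegral_energy_step hp hp1 hq hq1 m t _ hf] at h
    rw [Function.iterate_succ_apply, ← ih fun e => ?_, ← h]
    · rfl
    · simpa [batteryStep.const] using
        batteryStep.mono_fun hp hp1 hq hq1 (f := fun _ => 0) hf e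

end HarvestingNetwork

/-! ### Transmission probability, marks and Palm averages -/

namespace HarvestingNetwork

variable {Ω : Type*} [MeasurableSpace Ω] {P : Measure Ω} {lam p σ : ℝ}
  (N : HarvestingNetwork P lam p σ)

/-- The probability that a transmitter with access probability `q` has energy at time `t`. -/
noncomputable def nonemptyProb (q : ℝ) (t : ℕ) : ℝ≥0∞ :=
  ∫⁻ ω, ENNReal.ofReal ((batteryStep p q)^[t] (batteryStep.atLeast 1) (N.init 0 ω)) ∂P

lemma measurable_energy' (q : ℝ) (m t : ℕ) : Measurable (N.energy q m t) :=
  (N.measurable_energy q m t).mono (N.known_le _) le_rfl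

lemma measurableSet_energy (q : ℝ) (m t : ℕ) : MeasurableSet {ω | 1 ≤ N.energy q m t ω} :=
  measurableSet_le measurable_const (N.measurable_energy' q m t)

lemma measure_energy [IsProbabilityMeasure P] (hp : 0 ≤ p) (hp1 : p ≤ 1) {q : ℝ}
    (hq : 0 ≤ q) (hq1 : q ≤ 1) (m t : ℕ) :
    P {ω | 1 ≤ N.energy q m t ω} = N.nonemptyProb q t := by
  have h1 := N.lintegral_comp_energy hp hp1 hq hq1 m t (batteryStep.atLeast_nonneg 1)
  have h2 := ((N.init_law m).comp (u := fun e => ENNReal.ofReal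
    ((batteryStep p q)^[t] (batteryStep.atLeast 1) e)) measurable_from_top).lintegral_eq
  simp only [Function.comp] at h2
  rw [nonemptyProb, ← h2, ← h1, ← lintegral_indicator_one (N.measurableSet_energy q m t)]
  refine lintegral_congr fun ω => ?_
  by_cases h : 1 ≤ N.energy q m t ω <;> simp [batteryStep.atLeast, h]

/-- The limit is the same from every initial energy, so dominated convergence disposes of the
arbitrary initial law. -/
lemma tendsto_nonemptyProb [IsProbabilityMeasure P] (hp : 0 < p) (hp1 : p ≤ 1) {q : ℝ}
    (hq : 0 ≤ q) (hq1 : q ≤ 1) :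
    Tendsto (N.nonemptyProb q) atTop (𝓝 (ENNReal.ofReal (if q ≤ p then 1 else p / q))) := by
  have h : Tendsto (N.nonemptyProb q) atTop
      (𝓝 (∫⁻ _, ENNReal.ofReal (if q ≤ p then 1 else p / q) ∂P)) := by
    refine tendsto_lintegral_of_dominated_convergence (fun _ => 1) (fun t => ?_)
      (fun t => ae_of_all _ fun ω => ?_) (by simp) (ae_of_all _ fun ω => ?_)
    · exact (measurable_from_top (f := fun e => ENNReal.ofReal
        ((batteryStep p q)^[t] (batteryStep.atLeast 1) e))).comp (N.init_measurable 0)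
    · exact ENNReal.ofReal_le_one.2
        (batteryStep.iterate_le_one hp.le hp1 hq hq1 (batteryStep.atLeast_le_one 1) t _)
    · exact ENNReal.tendsto_ofReal (batteryStep.tendsto_nonempty hp hp1 hq hq1 _)
  simpa using h

/-- The probability that a transmitter with access probability `q` transmits at time `t`. -/
noncomputable def transmitProb (q : ℝ) (t : ℕ) : ℝ≥0∞ := ENNReal.ofReal q * N.nonemptyProb q t

lemma measurableSet_transmits (q : ℝ) (m t : ℕ) : MeasurableSet {ω | N.Transmits q m t ω} :=
  (N.measurableSet_energy q m t).inter (measurableSet_lt (N.coin_measurable m t) measurable_const)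

lemma measure_transmits [IsProbabilityMeasure P] (hp : 0 ≤ p) (hp1 : p ≤ 1) {q : ℝ}
    (hq : 0 ≤ q) (hq1 : q ≤ 1) (m t : ℕ) :
    P {ω | N.Transmits q m t ω} = N.transmitProb q t := by
  have hdisj : Disjoint (energySources m t) {Source.coin m t} := by
    refine Set.disjoint_left.2 ?_
    rintro i (rfl | ⟨s, hs, rfl | rfl⟩) h <;> simp_all
  have h := (Indep_iff _ _ P).1 (N.indep_known hdisj) {ω | 1 ≤ N.energy q m t ω}
    {ω | N.coin m t ω < q} (N.measurable_energy q m t measurableSet_Ici)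
    (N.measurable_coin (Set.mem_singleton _) measurableSet_Iio)
  rw [N.measure_energy hp hp1 hq hq1, N.measure_coin_lt hq1, mul_comm] at h
  exact h

lemma transmitProb_le_one [IsProbabilityMeasure P] (hp : 0 ≤ p) (hp1 : p ≤ 1) {q : ℝ}
    (hq : 0 ≤ q) (hq1 : q ≤ 1) (t : ℕ) : N.transmitProb q t ≤ 1 := by
  rw [← N.measure_transmits hp hp1 hq hq1 0 t]
  exact prob_le_one

/-- For `q > p` the limit is `q * (p / q) = p`: in the long run every `q ≥ p` leads to the same
activity. -/
lemma tendsto_transmitProb [IsProbabilityMeasure P] (hp : 0 < p) (hp1 : p ≤ 1) {q : ℝ}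
    (hq : 0 ≤ q) (hq1 : q ≤ 1) :
    Tendsto (N.transmitProb q) atTop (𝓝 (ENNReal.ofReal (min q p))) := by
  have h := ENNReal.Tendsto.const_mul (a := ENNReal.ofReal q) (N.tendsto_nonemptyProb hp hp1 hq hq1)
    (Or.inr ENNReal.ofReal_ne_top)
  rw [← ENNReal.ofReal_mul hq] at h
  convert! h using 3
  split_ifs with hqp
  · rw [min_eq_left hqp, mul_one]
  · have := not_le.1 hqp
    rw [min_eq_right this.le, mul_div_cancel₀ _ (hp.trans this).ne']

open Classical in
/-- The fading power from the transmitter `s`, with access probability `q`, to the receiver `n` if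
`s` transmits at time `t`, and zero otherwise. -/
noncomputable def mark (q : ℝ) (n s t : ℕ) (ω : Ω) : ℝ≥0∞ :=
  if N.Transmits q s t ω then ‖N.fade n s ω‖ₑ ^ 2 else 0

/-- The sources that determine the mark of the transmitter `s` at the receiver `n`. -/
def markSources (n s t : ℕ) : Set Source := {.fade n s, .coin s t} ∪ energySources s t

lemma measurableSet_transmits_known (q : ℝ) (n s t : ℕ) :
    MeasurableSet[N.known (markSources n s t)] {ω | N.Transmits q s t ω} := by
  have h1 : Measurable[N.known (markSources n s t)] (N.energy q s t) :=
    (N.measurable_energy q s t).mono (N.known_mono Set.subset_union_right) le_rfl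
  have h2 : Measurable[N.known (markSources n s t)] (N.coin s t) :=
    N.measurable_coin (Or.inl (Or.inr rfl))
  exact MeasurableSet.inter (h1 measurableSet_Ici) (h2 measurableSet_Iio)

lemma measurable_mark (q : ℝ) (n s t : ℕ) :
    Measurable[N.known (markSources n s t)] (N.mark q n s t) := by
  have h : Measurable[N.known (markSources n s t)] (N.fade n s) :=
    N.measurable_fade (Or.inl (Or.inl rfl))
  have h' : Measurable fun z : ℂ => ‖z‖ₑ ^ 2 := by fun_prop
  exact Measurable.ite (N.measurableSet_transmits_known q n s t) (h'.comp h) measurable_const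

lemma lintegral_comp_norm_fade (n s : ℕ) {f : ℝ → ℝ≥0∞} (hf : Measurable f) :
    ∫⁻ ω, f ‖N.fade n s ω‖ ∂P = ∫⁻ x, f x ∂rayleighMeasure σ := by
  rw [← N.fade_law n s, lintegral_map hf (N.fade_measurable n s).norm]

/-- The Laplace transform of a mark. -/
lemma lintegral_negExp_mark [IsProbabilityMeasure P] (hσ : 0 < σ) (hp : 0 ≤ p) (hp1 : p ≤ 1)
    {q : ℝ} (hq : 0 ≤ q) (hq1 : q ≤ 1) (n s t : ℕ) (a : ℝ≥0∞) :
    ∫⁻ ω, negExp (ENNReal.ofReal (1 / (2 * σ ^ 2)) * a * N.mark q n s t ω) ∂P =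
      1 - N.transmitProb q t + N.transmitProb q t * (1 + a)⁻¹ := by
  classical
  have hdisj : Disjoint (insert (.coin s t) (energySources s t)) {Source.fade n s} := by
    refine Set.disjoint_left.2 ?_
    rintro i (rfl | rfl | ⟨s, hs, rfl | rfl⟩) h <;> simp_all
  have hL : Measurable[N.known (insert (.coin s t) (energySources s t))]
      fun ω => (N.energy q s t ω, N.coin s t ω) :=
    ((N.measurable_energy q s t).mono (N.known_mono (Set.subset_insert _ _)) le_rfl).prodMk
      (N.measurable_coin (Set.mem_insert _ _))
  have hZ := N.measurable_fade (S := {Source.fade n s}) (Set.mem_singleton _)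
  have hR : Measurable fun x : ℝ =>
      negExp (ENNReal.ofReal (1 / (2 * σ ^ 2)) * a * ENNReal.ofReal x ^ 2) :=
    measurable_negExp.comp (by fun_prop)
  have hφ : Measurable (Function.uncurry fun (l : ℕ × ℝ) (z : ℂ) => if 1 ≤ l.1 ∧ l.2 < q then
      negExp (ENNReal.ofReal (1 / (2 * σ ^ 2)) * a * ENNReal.ofReal ‖z‖ ^ 2) else 1) := by
    refine Measurable.ite (MeasurableSet.inter ?_ ?_) (hR.comp measurable_snd.norm) measurable_const
    · exact measurableSet_le measurable_const measurable_fst.fst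
    · exact measurableSet_lt measurable_fst.snd measurable_const
  have h := N.lintegral_of_disjoint hdisj hL hZ hφ
  have hin : ∀ ω, ∫⁻ ω', (if 1 ≤ N.energy q s t ω ∧ N.coin s t ω < q then
      negExp (ENNReal.ofReal (1 / (2 * σ ^ 2)) * a * ENNReal.ofReal ‖N.fade n s ω'‖ ^ 2) else 1) ∂P =
      {ω | N.Transmits q s t ω}.indicator (fun _ => (1 + a)⁻¹) ω +
        {ω | N.Transmits q s t ω}ᶜ.indicator 1 ω := by
    intro ω
    by_cases hT : N.Transmits q s t ω
    · have hT' : 1 ≤ N.energy q s t ω ∧ N.coin s t ω < q := hT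
      simp only [hT', and_self, if_true]
      rw [N.lintegral_comp_norm_fade n s hR, lintegral_negExp_sq_rayleighMeasure hσ,
        Set.indicator_of_mem (by exact hT),
        Set.indicator_of_notMem (fun h : ω ∈ {ω | N.Transmits q s t ω}ᶜ => h hT), add_zero]
    · have hT' : ¬ (1 ≤ N.energy q s t ω ∧ N.coin s t ω < q) := hT
      simp only [hT', if_false]
      rw [Set.indicator_of_notMem (by exact hT), Set.indicator_of_mem (by exact hT)]
      simp
  have hm := N.measurableSet_transmits q s t
  simp_rw [hin] at h
  rw [lintegral_add_left (measurable_const.indicator hm), lintegral_indicator_const hm,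
    lintegral_indicator_one hm.compl, prob_compl_eq_one_sub hm,
    N.measure_transmits hp hp1 hq hq1, add_comm, mul_comm (1 + a)⁻¹] at h
  rw [← h]
  refine lintegral_congr fun ω => ?_
  unfold mark Transmits
  split_ifs <;> simp

lemma tsum_measure_loc [IsProbabilityMeasure P] (hlam : 0 ≤ lam) {A : Set Plane}
    (hA : MeasurableSet A) (hA' : volume A < ∞) :
    ∑' n, P {ω | N.loc n ω ∈ A} = ENNReal.ofReal lam * volume A := by
  have hm : ∀ n, Measurable fun ω => A.indicator (1 : Plane → ℝ≥0∞) (N.loc n ω) := fun n =>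
    (measurable_one.indicator hA).comp (N.loc_poisson.measurable n)
  rw [← N.loc_poisson.lintegral_tsum_indicator hlam hA hA',
    lintegral_tsum fun n => (hm n).aemeasurable]
  refine tsum_congr fun n => ?_
  exact (lintegral_indicator_one (N.loc_poisson.measurable n hA)).symm

/-- The denominator `lam * volume A` cancels because it is neither `0` nor `∞`; the window then
disappears. -/
lemma typicalProb_eq [IsProbabilityMeasure P] (hlam : 0 < lam) {A : Set Plane}
    (hA : MeasurableSet A) (hA0 : volume A ≠ 0) (hA' : volume A < ∞) {S : ℕ → Set Ω} {c : ℝ≥0∞}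
    (h : ∑' n, P ({ω | N.loc n ω ∈ A} ∩ S n) = c * (ENNReal.ofReal lam * volume A)) :
    N.typicalProb A S = c.toReal := by
  rw [typicalProb, h, N.tsum_measure_loc hlam.le hA hA', ENNReal.mul_div_cancel_right]
  · exact mul_ne_zero (by simpa using hlam) hA0
  · exact ENNReal.mul_ne_top ENNReal.ofReal_ne_top hA'.ne

/-- Energies are independent of locations, so the Palm probability is the ordinary one. -/
lemma energyProbAt_eq [IsProbabilityMeasure P] (hlam : 0 < lam) (hp : 0 ≤ p) (hp1 : p ≤ 1) {q : ℝ}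
    (hq : 0 ≤ q) (hq1 : q ≤ 1) {A : Set Plane} (hA : MeasurableSet A) (hA0 : volume A ≠ 0)
    (hA' : volume A < ∞) (t : ℕ) : N.energyProbAt A q t = (N.nonemptyProb q t).toReal := by
  refine N.typicalProb_eq hlam hA hA0 hA' ?_
  rw [← N.tsum_measure_loc hlam.le hA hA', ← ENNReal.tsum_mul_left]
  refine tsum_congr fun n => ?_
  have hdisj : Disjoint {Source.loc} (energySources n t) := by
    refine Set.disjoint_left.2 ?_
    rintro i h (rfl | ⟨s, hs, rfl | rfl⟩) <;> simp_all
  have h := (Indep_iff _ _ P).1 (N.indep_known hdisj) {ω | N.loc n ω ∈ A}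
    {ω | 1 ≤ N.energy q n t ω} (N.measurable_loc (Set.mem_singleton _) n hA)
    (N.measurable_energy q n t measurableSet_Ici)
  rw [h, N.measure_energy hp hp1 hq hq1, mul_comm]

end HarvestingNetwork

/-! ### Averaging over the marks of the interferers -/

/-- The probability that a relative interference `a`, multiplied by an exponential fading power of
mean one and present with probability `τ`, is harmless for a signal with such a fading. -/
noncomputable def harmlessProb (τ a : ℝ≥0∞) : ℝ≥0∞ := 1 - τ + τ * (1 + a)⁻¹

lemma harmlessProb_le_one {τ : ℝ≥0∞} (hτ : τ ≤ 1) (a : ℝ≥0∞) : harmlessProb τ a ≤ 1 := by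
  have h : (1 + a)⁻¹ ≤ 1 := ENNReal.inv_le_one.2 le_self_add
  calc 1 - τ + τ * (1 + a)⁻¹ ≤ 1 - τ + τ * 1 := by gcongr
    _ = 1 := by rw [mul_one, tsub_add_cancel_of_le hτ]

lemma one_sub_harmlessProb {τ : ℝ≥0∞} (hτ : τ ≤ 1) (a : ℝ≥0∞) :
    1 - harmlessProb τ a = τ * (1 - (1 + a)⁻¹) := by
  have hτ' : τ ≠ ∞ := (hτ.trans_lt ENNReal.one_lt_top).ne
  have h : (1 + a)⁻¹ ≤ 1 := ENNReal.inv_le_one.2 le_self_add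
  have h' : τ * (1 + a)⁻¹ ≤ τ := (mul_le_mul_right h τ).trans_eq (mul_one τ)
  rw [ENNReal.mul_sub fun _ _ => hτ', mul_one, harmlessProb]
  refine ENNReal.sub_eq_of_eq_add ((harmlessProb_le_one hτ a).trans_lt ENNReal.one_lt_top).ne ?_
  rw [add_comm (1 - τ), ← add_assoc, tsub_add_cancel_of_le h', add_tsub_cancel_of_le hτ]

lemma continuous_harmlessProb {τ : ℝ≥0∞} (hτ : τ ≤ 1) : Continuous (harmlessProb τ) := by
  have h : Continuous fun a : ℝ≥0∞ => (1 + a)⁻¹ := by fun_prop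
  exact continuous_const.add
    ((ENNReal.continuous_const_mul (hτ.trans_lt ENNReal.one_lt_top).ne).comp h)

namespace HarvestingNetwork

variable {Ω : Type*} [MeasurableSpace Ω] {P : Measure Ω} {lam p σ : ℝ}
  (N : HarvestingNetwork P lam p σ)

/-- The own access probability `q` enters only at `s = n`, which is excluded; hence it has no
influence on the success probability. -/
lemma interference_update (d α q q' : ℝ) (n t : ℕ) (ω : Ω) :
    N.interference d α (Function.update (fun _ => q') n q) n t ω =
      ∑' s, if s = n then 0 else
        edist (N.loc s ω) (N.receiver d n ω) ^ (-α) * N.mark q' n s t ω := by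
  unfold interference
  refine tsum_congr fun s => ?_
  by_cases hs : s = n
  · simp [hs]
  · rw [if_neg hs, Function.update_of_ne hs, mark]
    by_cases hT : N.Transmits q' s t ω <;> simp [hs, hT]

lemma measurable_edist_offset (d : ℝ) :
    Measurable fun x : Plane × Plane × Metric.sphere (0 : Plane) 1 =>
      edist x.1 (x.2.1 + d • (x.2.2 : Plane)) := by
  have h1 : Measurable fun x : Plane × Plane × Metric.sphere (0 : Plane) 1 => (x.2.2 : Plane) :=
    measurable_subtype_coe.comp measurable_snd.snd
  have h2 : Measurable fun x : Plane × Plane × Metric.sphere (0 : Plane) 1 => d • (x.2.2 : Plane) :=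
    h1.const_smul d
  have h3 : Measurable fun x : Plane × Plane × Metric.sphere (0 : Plane) 1 => x.2.1 + d • (x.2.2 : Plane) :=
    measurable_snd.fst.add h2
  exact measurable_fst.edist h3

lemma measurable_edist_receiver {S : Set Source} (hl : Source.loc ∈ S) (hr : Source.dir ∈ S)
    (d : ℝ) (n s : ℕ) :
    Measurable[N.known S] fun ω => edist (N.loc s ω) (N.receiver d n ω) := by
  have h' : Measurable[N.known S] fun ω => (N.loc s ω, N.loc n ω, N.dir n ω) :=
    (N.measurable_loc hl s).prodMk ((N.measurable_loc hl n).prodMk (N.measurable_dir hr n))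
  have h := Measurable.comp (measurable_edist_offset d) h'
  exact h

lemma markSources_subset_compl_loc (n s t : ℕ) :
    ({.loc, .dir} : Set Source) ⊆ (markSources n s t)ᶜ := by
  rintro i (rfl | rfl) ((h | h) | (h | ⟨r, hr, h | h⟩)) <;> simp_all

/-- Different transmitters have different fading coefficients, batteries and coins, so the marks at
one receiver and one time are independent. -/
lemma markSources_subset_compl {n s r t : ℕ} (hsr : r ≠ s) :
    markSources n r t ⊆ (markSources n s t)ᶜ := by
  rintro i ((rfl | rfl) | (rfl | ⟨u, hu, rfl | rfl⟩)) ((h | h) | (h | ⟨v, hv, h | h⟩)) <;> simp_all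

lemma markSources_subset_compl_fade {n s t : ℕ} (hs : s ≠ n) :
    markSources n s t ⊆ ({.fade n n} : Set Source)ᶜ := by
  rintro i ((rfl | rfl) | (rfl | ⟨u, hu, rfl | rfl⟩)) h <;> simp_all

/-- Averaging over finitely many marks. -/
lemma lintegral_mul_prod_mark [IsProbabilityMeasure P] (hσ : 0 < σ) (hp : 0 ≤ p) (hp1 : p ≤ 1)
    {q : ℝ} (hq : 0 ≤ q) (hq1 : q ≤ 1) (n t : ℕ) {a : ℕ → Ω → ℝ≥0∞}
    (ha : ∀ s, Measurable[N.known {.loc, .dir}] (a s)) (F : Finset ℕ) {Y : Ω → ℝ≥0∞}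
    (hY : Measurable[N.known {.loc, .dir}] Y) :
    ∫⁻ ω, Y ω * ∏ s ∈ F, negExp (ENNReal.ofReal (1 / (2 * σ ^ 2)) * a s ω * N.mark q n s t ω) ∂P =
      ∫⁻ ω, Y ω * ∏ s ∈ F, harmlessProb (N.transmitProb q t) (a s ω) ∂P := by
  induction F using Finset.induction_on generalizing Y with
  | empty => rfl
  | insert s F hs ih =>
    set C := ENNReal.ofReal (1 / (2 * σ ^ 2)) with hC
    have hle := N.known_mono (markSources_subset_compl_loc n s t)
    have hL : Measurable[N.known (markSources n s t)ᶜ] fun ω =>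
        (Y ω * ∏ r ∈ F, negExp (C * a r ω * N.mark q n r t ω), a s ω) := by
      refine Measurable.prodMk (Measurable.mul (hY.mono hle le_rfl)
        (Finset.measurable_fun_prod _ fun r hr => measurable_negExp.comp
          (Measurable.mul (Measurable.mul measurable_const ((ha r).mono hle le_rfl)) ?_)))
        ((ha s).mono hle le_rfl)
      exact (N.measurable_mark q n r t).mono
        (N.known_mono (markSources_subset_compl (ne_of_mem_of_not_mem hr hs))) le_rfl
    have hφ : Measurable (Function.uncurry fun (l : ℝ≥0∞ × ℝ≥0∞) (z : ℝ≥0∞) =>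
        l.1 * negExp (C * l.2 * z)) :=
      measurable_fst.fst.mul (measurable_negExp.comp (by fun_prop))
    -- Everything but the mark of `s` is frozen. The averaged factor depends on the geometry alone,
    -- so it can be absorbed into `Y`, over which the induction is generalized.
    have h := N.lintegral_of_disjoint disjoint_compl_left hL (N.measurable_mark q n s t) hφ
    have hin : ∀ y b : ℝ≥0∞, ∫⁻ ω, y * negExp (C * b * N.mark q n s t ω) ∂P =
        y * harmlessProb (N.transmitProb q t) b := fun y b => by
      have hm : Measurable (N.mark q n s t) := (N.measurable_mark q n s t).mono (N.known_le _) le_rfl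
      have hm' : Measurable fun ω => negExp (C * b * N.mark q n s t ω) :=
        measurable_negExp.comp (hm.const_mul _)
      rw [lintegral_const_mul _ hm',
        N.lintegral_negExp_mark hσ hp hp1 hq hq1, harmlessProb]
    simp only [hin] at h
    have hτ := N.transmitProb_le_one hp hp1 hq hq1 t
    have hY' : Measurable[N.known {.loc, .dir}]
        fun ω => Y ω * harmlessProb (N.transmitProb q t) (a s ω) :=
      Measurable.mul hY ((continuous_harmlessProb hτ).measurable.comp (ha s))
    calc _ = ∫⁻ ω, Y ω * (∏ r ∈ F, negExp (C * a r ω * N.mark q n r t ω)) *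
            negExp (C * a s ω * N.mark q n s t ω) ∂P := by
          refine lintegral_congr fun ω => ?_
          rw [Finset.prod_insert hs]; ring
      _ = ∫⁻ ω, (Y ω * harmlessProb (N.transmitProb q t) (a s ω)) *
            ∏ r ∈ F, negExp (C * a r ω * N.mark q n r t ω) ∂P := by
          rw [h]
          refine lintegral_congr fun ω => ?_
          ring
      _ = _ := by
          rw [ih hY']
          refine lintegral_congr fun ω => ?_
          rw [Finset.prod_insert hs]; ring

/-- Averaging over the marks of all interferers. -/
lemma lintegral_mul_negExp_tsum_mark [IsProbabilityMeasure P] (hσ : 0 < σ) (hp : 0 ≤ p)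
    (hp1 : p ≤ 1) {q : ℝ} (hq : 0 ≤ q) (hq1 : q ≤ 1) (n t : ℕ) {a : ℕ → Ω → ℝ≥0∞}
    (ha : ∀ s, Measurable[N.known {.loc, .dir}] (a s)) {Y : Ω → ℝ≥0∞}
    (hY : Measurable[N.known {.loc, .dir}] Y) (hY1 : ∀ ω, Y ω ≤ 1) :
    ∫⁻ ω, Y ω * negExp (∑' s, if s = n then 0 else
        ENNReal.ofReal (1 / (2 * σ ^ 2)) * a s ω * N.mark q n s t ω) ∂P =
      ∫⁻ ω, Y ω * negExp (∑' s, if s = n then 0 else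
        negLog (harmlessProb (N.transmitProb q t) (a s ω))) ∂P := by
  have hτ := N.transmitProb_le_one hp hp1 hq hq1 t
  have hYm : Measurable Y := hY.mono (N.known_le _) le_rfl
  have ham : ∀ s, Measurable (a s) := fun s => (ha s).mono (N.known_le _) le_rfl
  -- Both sides are limits of finite products bounded by `1`. On the right the product is kept as
  -- `negExp` of a sum of `negLog`, the shape required by the Mecke formula.
  have hlim : ∀ b : ℕ → Ω → ℝ≥0∞, (∀ s, Measurable (b s)) →
      Tendsto (fun k => ∫⁻ ω, Y ω * ∏ s ∈ Finset.range k with s ≠ n, negExp (b s ω) ∂P) atTop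
        (𝓝 (∫⁻ ω, Y ω * negExp (∑' s, if s = n then 0 else b s ω) ∂P)) := by
    intro b hb
    refine tendsto_lintegral_of_dominated_convergence (fun _ => 1) (fun k => ?_)
      (fun k => ae_of_all _ fun ω => ?_) (by simp) (ae_of_all _ fun ω => ?_)
    · exact hYm.mul (Finset.measurable_fun_prod _ fun s _ => measurable_negExp.comp (hb s))
    · exact mul_le_one' (hY1 ω) (Finset.prod_le_one' fun s _ => negExp_le_one _)
    · refine ENNReal.Tendsto.const_mul ?_ (Or.inr ((hY1 ω).trans_lt ENNReal.one_lt_top).ne)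
      refine (negExp_tsum _).congr fun k => ?_
      rw [Finset.prod_filter]
      refine Finset.prod_congr rfl fun s _ => ?_
      by_cases hs : s = n <;> simp [hs]
  refine tendsto_nhds_unique (hlim _ fun s => ?_) ((hlim _ fun s => ?_).congr fun k => ?_)
  · exact ((ham s).const_mul _).mul ((N.measurable_mark q n s t).mono (N.known_le _) le_rfl)
  · exact continuous_negLog.measurable.comp ((continuous_harmlessProb hτ).measurable.comp (ham s))
  · rw [N.lintegral_mul_prod_mark hσ hp hp1 hq hq1 n t ha _ hY]
    simp_rw [negExp_negLog (harmlessProb_le_one hτ _)]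

end HarvestingNetwork

/-! ### Mean effect of an interferer over the plane -/

/-- `-log` of the probability that an interferer at `z` is harmless for a transmitter at `x` with
receiver at `x + d u`. -/
noncomputable def interfererCost (d α θ : ℝ) (τ : ℝ≥0∞) (u : Metric.sphere (0 : Plane) 1)
    (x z : Plane) : ℝ≥0∞ :=
  negLog (harmlessProb τ (ENNReal.ofReal (θ * d ^ α) * edist z (x + d • (u : Plane)) ^ (-α)))

lemma continuous_interfererCost (d α θ : ℝ) {τ : ℝ≥0∞} (hτ : τ ≤ 1) :
    Continuous fun y : Metric.sphere (0 : Plane) 1 × Plane × Plane =>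
      interfererCost d α θ τ y.1 y.2.1 y.2.2 := by
  have h1 : Continuous fun y : Metric.sphere (0 : Plane) 1 × Plane × Plane =>
      edist y.2.2 (y.2.1 + d • (y.1 : Plane)) :=
    continuous_snd.snd.edist
      (continuous_snd.fst.add ((continuous_subtype_val.comp continuous_fst).const_smul d))
  exact continuous_negLog.comp ((continuous_harmlessProb hτ).comp
    ((ENNReal.continuous_const_mul ENNReal.ofReal_ne_top).comp
      (ENNReal.continuous_rpow_const.comp h1)))

lemma continuous_uncurry_interfererCost (d α θ : ℝ) {τ : ℝ≥0∞} (hτ : τ ≤ 1)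
    (u : Metric.sphere (0 : Plane) 1) :
    Continuous (Function.uncurry (interfererCost d α θ τ u)) := by
  have h1 : Continuous fun y : Plane × Plane => (u, y) := by fun_prop
  have h2 := (continuous_interfererCost d α θ hτ).comp h1
  exact h2

lemma measurable_interfererCost (d α θ : ℝ) {τ : ℝ≥0∞} (hτ : τ ≤ 1) (n s : ℕ) :
    Measurable fun y : Metric.sphere (0 : Plane) 1 × (ℕ → Plane) =>
      interfererCost d α θ τ y.1 (y.2 n) (y.2 s) := by
  have h1 : Measurable fun y : Metric.sphere (0 : Plane) 1 × (ℕ → Plane) =>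
      (y.1, y.2 n, y.2 s) :=
    measurable_fst.prodMk (((measurable_pi_apply n).comp measurable_snd).prodMk
      ((measurable_pi_apply s).comp measurable_snd))
  have h2 := (continuous_interfererCost d α θ hτ).measurable.comp h1
  exact h2

/-- Translation invariance moves the receiver to the origin, so neither `x` nor `u` matters; this is
why the law of the orientations may be arbitrary. With `c = θ * d ^ α` the factor `c ^ (2 / α)` is
`θ ^ (2 / α) * d ^ 2`. -/
lemma lintegral_one_sub_negExp_interfererCost {d α θ : ℝ} (hd : 0 < d) (hα : 2 < α) (hθ : 0 < θ)
    {τ : ℝ≥0∞} (hτ : τ ≤ 1) (u : Metric.sphere (0 : Plane) 1) (x : Plane) :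
    ∫⁻ z, (1 - negExp (interfererCost d α θ τ u x z)) = τ * ENNReal.ofReal (1 / lamMax d α θ) := by
  have hα0 : α ≠ 0 := by linarith
  have h1 : ∀ z, 1 - negExp (interfererCost d α θ τ u x z) =
      τ * (1 - (1 + ENNReal.ofReal (θ * d ^ α) * ‖z - (x + d • (u : Plane))‖ₑ ^ (-α))⁻¹) := fun z => by
    rw [interfererCost, negExp_negLog (harmlessProb_le_one hτ _), one_sub_harmlessProb hτ,
      edist_eq_enorm_sub]
  simp_rw [h1]
  rw [lintegral_const_mul' _ _ (hτ.trans_lt ENNReal.one_lt_top).ne,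
    lintegral_sub_right_eq_self
      (fun z : Plane => 1 - (1 + ENNReal.ofReal (θ * d ^ α) * ‖z‖ₑ ^ (-α))⁻¹) (x + d • (u : Plane)),
    lintegral_plane_path_loss hα (by positivity), lamMax, one_div_one_div,
    Real.mul_rpow hθ.le (by positivity), ← Real.rpow_mul hd.le, mul_div_cancel₀ _ hα0,
    Real.rpow_two, mul_comm (θ ^ _)]

/-! ### Success probability of the typical transmitter -/

namespace HarvestingNetwork

variable {Ω : Type*} [MeasurableSpace Ω] {P : Measure Ω} {lam p σ : ℝ}
  (N : HarvestingNetwork P lam p σ)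

lemma measurable_tsum_ennreal {E : Type*} {m : MeasurableSpace E} {f : ℕ → E → ℝ≥0∞}
    (hf : ∀ s, Measurable (f s)) : Measurable fun x => ∑' s, f s x :=
  Measurable.tsum hf

lemma measurable_seq {E F : Type*} {m : MeasurableSpace E} [MeasurableSpace F] {f : ℕ → E → F}
    (hf : ∀ s, Measurable (f s)) : Measurable fun x s => f s x :=
  measurable_pi_lambda _ hf

/-- Clearing the denominator remains valid when the interference is `0` or `∞`. -/
lemma lt_sir_iff {d α θ : ℝ} (hθ : 0 < θ) (prof : ℕ → ℝ) (n t : ℕ) (ω : Ω) :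
    ENNReal.ofReal θ < N.sir d α prof n t ω ↔ ENNReal.ofReal θ * N.interference d α prof n t ω <
      ENNReal.ofReal (d ^ (-α)) * ENNReal.ofReal ‖N.fade n n ω‖ ^ 2 := by
  rw [sir, ENNReal.lt_div_iff_mul_lt (Or.inr ENNReal.ofReal_ne_top) (Or.inr (by simpa using hθ)),
    ofReal_norm]

/-- The success event, averaged over the fading of the signal. -/
lemma measure_inter_success [IsProbabilityMeasure P] (hσ : 0 < σ) {d α θ q q' : ℝ} (hd : 0 < d)
    (hθ : 0 < θ) (n t : ℕ) {A : Set Plane} (hA : MeasurableSet A) :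
    P ({ω | N.loc n ω ∈ A} ∩ {ω | ENNReal.ofReal θ <
        N.sir d α (Function.update (fun _ => q') n q) n t ω}) =
      ∫⁻ ω, A.indicator 1 (N.loc n ω) * negExp (∑' s, if s = n then 0 else
        ENNReal.ofReal (1 / (2 * σ ^ 2)) * (ENNReal.ofReal (θ * d ^ α) *
          edist (N.loc s ω) (N.receiver d n ω) ^ (-α)) * N.mark q' n s t ω) ∂P := by
  set I := N.interference d α (Function.update (fun _ => q') n q) n t with hI
  -- The interference at receiver `n` involves only `fade n s` with `s ≠ n`, so the signal fading
  -- can be averaged with all else frozen.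
  set S : Set Source := {.fade n n}ᶜ with hS
  have hloc : Measurable[N.known S] (N.loc n) := N.measurable_loc (by simp [hS]) n
  have hIm : Measurable[N.known S] I := by
    have : I = fun ω => ∑' s, if s = n then 0 else
        edist (N.loc s ω) (N.receiver d n ω) ^ (-α) * N.mark q' n s t ω :=
      funext fun ω => N.interference_update d α q q' n t ω
    rw [this]
    refine measurable_tsum_ennreal fun s => ?_
    split_ifs with hs
    · exact measurable_const
    · have h1 : Measurable[N.known S] fun ω => edist (N.loc s ω) (N.receiver d n ω) :=
        N.measurable_edist_receiver (by simp [hS]) (by simp [hS]) d n s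
      exact Measurable.mul (ENNReal.continuous_rpow_const.measurable.comp h1)
        ((N.measurable_mark q' n s t).mono (N.known_mono (markSources_subset_compl_fade hs)) le_rfl)
  have hYm : Measurable[N.known S] fun ω => A.indicator (1 : Plane → ℝ≥0∞) (N.loc n ω) :=
    (measurable_one.indicator hA).comp hloc
  have hL : Measurable[N.known S] fun ω => (A.indicator (1 : Plane → ℝ≥0∞) (N.loc n ω), I ω) :=
    hYm.prodMk hIm
  have hZ := N.measurable_fade (S := {Source.fade n n}) (Set.mem_singleton _)
  have hset : MeasurableSet {y : (ℝ≥0∞ × ℝ≥0∞) × ℂ | ENNReal.ofReal θ * y.1.2 <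
      ENNReal.ofReal (d ^ (-α)) * ENNReal.ofReal ‖y.2‖ ^ 2} :=
    measurableSet_lt (by fun_prop) (by fun_prop)
  have hφ : Measurable (Function.uncurry fun (l : ℝ≥0∞ × ℝ≥0∞) (z : ℂ) =>
      l.1 * {y : (ℝ≥0∞ × ℝ≥0∞) × ℂ | ENNReal.ofReal θ * y.1.2 <
        ENNReal.ofReal (d ^ (-α)) * ENNReal.ofReal ‖y.2‖ ^ 2}.indicator 1 (l, z)) :=
    measurable_fst.fst.mul (measurable_one.indicator hset)
  have h := N.lintegral_of_disjoint disjoint_compl_left hL hZ hφ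
  have hin : ∀ y i : ℝ≥0∞, ∫⁻ ω, y * {y : (ℝ≥0∞ × ℝ≥0∞) × ℂ | ENNReal.ofReal θ * y.1.2 <
        ENNReal.ofReal (d ^ (-α)) * ENNReal.ofReal ‖y.2‖ ^ 2}.indicator 1 ((y, i), N.fade n n ω) ∂P =
      y * negExp (ENNReal.ofReal (1 / (2 * σ ^ 2)) * (ENNReal.ofReal (θ * d ^ α) * i)) := by
    intro y i
    have hm : MeasurableSet {x : ℝ | ENNReal.ofReal θ * i <
        ENNReal.ofReal (d ^ (-α)) * ENNReal.ofReal x ^ 2} :=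
      measurableSet_lt (by fun_prop) (by fun_prop)
    have hm' : Measurable fun ω => {y : (ℝ≥0∞ × ℝ≥0∞) × ℂ | ENNReal.ofReal θ * y.1.2 <
        ENNReal.ofReal (d ^ (-α)) * ENNReal.ofReal ‖y.2‖ ^ 2}.indicator
          (1 : (ℝ≥0∞ × ℝ≥0∞) × ℂ → ℝ≥0∞) ((y, i), N.fade n n ω) :=
      (measurable_one.indicator hset).comp (measurable_const.prodMk (N.fade_measurable n n))
    rw [lintegral_const_mul _ hm']
    congr 1
    have e := N.lintegral_comp_norm_fade n n (f := {x : ℝ | ENNReal.ofReal θ * i <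
        ENNReal.ofReal (d ^ (-α)) * ENNReal.ofReal x ^ 2}.indicator 1) (measurable_one.indicator hm)
    rw [lintegral_indicator_one hm, rayleighMeasure_lt_mul_sq hσ (by positivity)] at e
    refine Eq.trans ?_ (e.trans ?_)
    · rfl
    · rw [← mul_assoc (ENNReal.ofReal _), ← mul_assoc (ENNReal.ofReal _),
        ← ENNReal.ofReal_mul (by positivity),
        ← ENNReal.ofReal_mul (by positivity)]
      congr 3
      rw [Real.rpow_neg hd.le]
      field_simp
  simp only [hin] at h
  have hE : MeasurableSet {ω | ENNReal.ofReal θ <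
      N.sir d α (Function.update (fun _ => q') n q) n t ω} := by
    simp_rw [N.lt_sir_iff hθ]
    exact measurableSet_lt ((hIm.mono (N.known_le _) le_rfl).const_mul _)
      (((N.fade_measurable n n).norm.ennreal_ofReal.pow_const 2).const_mul _)
  refine (lintegral_indicator_one ((N.loc_poisson.measurable n hA).inter hE)).symm.trans ?_
  calc _ = ∫⁻ ω, A.indicator 1 (N.loc n ω) * {y : (ℝ≥0∞ × ℝ≥0∞) × ℂ | ENNReal.ofReal θ * y.1.2 <
        ENNReal.ofReal (d ^ (-α)) * ENNReal.ofReal ‖y.2‖ ^ 2}.indicator 1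
          ((A.indicator (1 : Plane → ℝ≥0∞) (N.loc n ω), I ω), N.fade n n ω) ∂P := by
        refine lintegral_congr fun ω => ?_
        have h1 := N.lt_sir_iff hθ (d := d) (α := α) (Function.update (fun _ => q') n q) n t ω
        by_cases h2 : N.loc n ω ∈ A
        · by_cases h3 : ENNReal.ofReal θ * I ω <
              ENNReal.ofReal (d ^ (-α)) * ENNReal.ofReal ‖N.fade n n ω‖ ^ 2
          · rw [Set.indicator_of_mem (by exact ⟨h2, h1.2 h3⟩), Set.indicator_of_mem h2,
              Set.indicator_of_mem (by exact h3)]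
            simp
          · rw [Set.indicator_of_notMem (fun h4 => h3 (h1.1 h4.2)),
              Set.indicator_of_notMem (a := ((_, I ω), N.fade n n ω)) (by exact h3), mul_zero]
        · rw [Set.indicator_of_notMem (fun h4 => h2 h4.1), Set.indicator_of_notMem h2, zero_mul]
    _ = _ := by
        rw [h]
        refine lintegral_congr fun ω => ?_
        rw [hI, N.interference_update]
        congr 2
        rw [← ENNReal.tsum_mul_left, ← ENNReal.tsum_mul_left]
        refine tsum_congr fun s => ?_
        split_ifs
        · simp
        · ring

/-- The Palm sum of the success events. -/
lemma tsum_measure_inter_success [IsProbabilityMeasure P] (hlam : 0 < lam) (hσ : 0 < σ)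
    (hp : 0 ≤ p) (hp1 : p ≤ 1) {d α θ q q' : ℝ} (hd : 0 < d) (hα : 2 < α) (hθ : 0 < θ)
    (hq' : 0 ≤ q') (hq1' : q' ≤ 1) (t : ℕ) {A : Set Plane} (hA : MeasurableSet A)
    (hA' : volume A < ∞) :
    ∑' n, P ({ω | N.loc n ω ∈ A} ∩ {ω | ENNReal.ofReal θ <
        N.sir d α (Function.update (fun _ => q') n q) n t ω}) =
      negExp (ENNReal.ofReal lam * (N.transmitProb q' t * ENNReal.ofReal (1 / lamMax d α θ))) *
        (ENNReal.ofReal lam * volume A) := by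
  have hτ := N.transmitProb_le_one hp hp1 hq' hq1' t
  set τ := N.transmitProb q' t with hτdef
  let φ : ℕ → Metric.sphere (0 : Plane) 1 → (ℕ → Plane) → ℝ≥0∞ := fun n u x =>
    A.indicator 1 (x n) * negExp (∑' s, if s = n then 0 else interfererCost d α θ τ u (x n) (x s))
  have hφ : ∀ n, Measurable (Function.uncurry (φ n)) := fun n => by
    refine Measurable.mul ((measurable_one.indicator hA).comp
      ((measurable_pi_apply n).comp measurable_snd))
      (measurable_negExp.comp (Measurable.tsum fun s => ?_))
    split_ifs
    · exact measurable_const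
    · exact measurable_interfererCost d α θ hτ n s
  have hdisj : Disjoint ({.dir} : Set Source) {.loc} := by simp
  have hlocs : Measurable[N.known {.loc}] fun ω s => N.loc s ω :=
    measurable_seq fun s => N.measurable_loc (Set.mem_singleton _) s
  have hlocs' : Measurable fun ω s => N.loc s ω := hlocs.mono (N.known_le _) le_rfl
  let H : ℕ → Metric.sphere (0 : Plane) 1 → ℝ≥0∞ := fun n u => ∫⁻ ω, φ n u (fun s => N.loc s ω) ∂P
  have hH : ∀ n, Measurable (H n) := fun n =>
    Measurable.lintegral_prod_right' (f := fun y : Metric.sphere (0 : Plane) 1 × Ω =>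
      φ n y.1 fun s => N.loc s y.2)
      ((hφ n).comp (measurable_fst.prodMk (hlocs'.comp measurable_snd)))
  -- The `n`-th term involves no orientation but `dir n`, which has the law of `dir 0`. Once all
  -- terms use `dir 0`, the sum over `n` can be taken at a fixed direction `u`, and the Mecke
  -- formula applies.
  have hterm : ∀ n, P ({ω | N.loc n ω ∈ A} ∩ {ω | ENNReal.ofReal θ <
        N.sir d α (Function.update (fun _ => q') n q) n t ω}) = ∫⁻ ω, H n (N.dir 0 ω) ∂P := by
    intro n
    have hind : Measurable[N.known {.loc, .dir}]
        fun ω => A.indicator (1 : Plane → ℝ≥0∞) (N.loc n ω) :=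
      (measurable_one.indicator hA).comp (N.measurable_loc (by simp) n)
    have ha : ∀ s, Measurable[N.known {.loc, .dir}] fun ω => ENNReal.ofReal (θ * d ^ α) *
        edist (N.loc s ω) (N.receiver d n ω) ^ (-α) := fun s => by
      have h1 : Measurable[N.known {.loc, .dir}] fun ω => edist (N.loc s ω) (N.receiver d n ω) :=
        N.measurable_edist_receiver (by simp) (by simp) d n s
      have h2 : Measurable fun r : ℝ≥0∞ => ENNReal.ofReal (θ * d ^ α) * r ^ (-α) := by fun_prop
      exact h2.comp h1
    rw [N.measure_inter_success hσ hd hθ n t hA,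
      N.lintegral_mul_negExp_tsum_mark hσ hp hp1 hq' hq1' n t ha hind fun ω => by
        by_cases h : N.loc n ω ∈ A <;> simp [h]]
    have h1 := N.lintegral_of_disjoint hdisj (N.measurable_dir (Set.mem_singleton _) n) hlocs (hφ n)
    have h2 := ((N.dir_law n).comp (hH n)).lintegral_eq
    exact h1.trans h2
  simp_rw [hterm]
  have hHdir : ∀ n, Measurable fun ω => H n (N.dir 0 ω) := fun n =>
    (hH n).comp (N.dir_measurable 0)
  rw [← lintegral_tsum fun n => (hHdir n).aemeasurable]
  have hsum : ∀ u, ∑' n, H n u = negExp (ENNReal.ofReal lam *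
      (τ * ENNReal.ofReal (1 / lamMax d α θ))) * (ENNReal.ofReal lam * volume A) := by
    intro u
    have hm : ∀ n, Measurable fun ω => φ n u fun s => N.loc s ω := fun n =>
      (hφ n).comp (measurable_const.prodMk hlocs')
    rw [← lintegral_tsum fun n => (hm n).aemeasurable]
    have hg := continuous_uncurry_interfererCost d α θ hτ u
    refine (N.loc_poisson.lintegral_tsum_negExp hlam.le hA hA' hg).trans ?_
    simp_rw [lintegral_one_sub_negExp_interfererCost hd hα hθ hτ]
    rw [setLIntegral_const]
    ring
  simp_rw [hsum]
  simp

lemma successProbAt_eq [IsProbabilityMeasure P] (hlam : 0 < lam) (hσ : 0 < σ)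
    (hp : 0 ≤ p) (hp1 : p ≤ 1) {d α θ : ℝ} (q : ℝ) {q' : ℝ} (hd : 0 < d) (hα : 2 < α) (hθ : 0 < θ)
    (hq' : 0 ≤ q') (hq1' : q' ≤ 1) {A : Set Plane} (hA : MeasurableSet A) (hA0 : volume A ≠ 0)
    (hA' : volume A < ∞) (t : ℕ) :
    N.successProbAt A d α θ q q' t = (negExp (ENNReal.ofReal lam *
      (N.transmitProb q' t * ENNReal.ofReal (1 / lamMax d α θ)))).toReal :=
  N.typicalProb_eq hlam hA hA0 hA'
    (N.tsum_measure_inter_success hlam hσ hp hp1 hd hα hθ hq' hq1' t hA hA')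

/-! ### Steady state and equilibrium -/

lemma tendsto_energyProbAt [IsProbabilityMeasure P] (hlam : 0 < lam) (hp : 0 < p) (hp1 : p ≤ 1)
    {q : ℝ} (hq : 0 ≤ q) (hq1 : q ≤ 1) {A : Set Plane} (hA : MeasurableSet A)
    (hA0 : volume A ≠ 0) (hA' : volume A < ∞) :
    Tendsto (N.energyProbAt A q) atTop (𝓝 (if q ≤ p then 1 else p / q)) := by
  have h0 : 0 ≤ if q ≤ p then 1 else p / q := by split_ifs <;> positivity
  have h := (ENNReal.tendsto_toReal ENNReal.ofReal_ne_top).comp (N.tendsto_nonemptyProb hp hp1 hq hq1)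
  rw [ENNReal.toReal_ofReal h0] at h
  exact h.congr fun t => (N.energyProbAt_eq hlam hp.le hp1 hq hq1 hA hA0 hA' t).symm

lemma lamMax_pos {d α θ : ℝ} (hd : 0 < d) (hα : 2 < α) (hθ : 0 < θ) : 0 < lamMax d α θ := by
  have hα0 : 0 < α := by linarith
  have hsin : 0 < Real.sin (2 * Real.pi / α) := by
    refine Real.sin_pos_of_pos_of_lt_pi (by positivity) ?_
    rw [div_lt_iff₀ hα0]
    nlinarith [Real.pi_pos]
  unfold lamMax pathLossConst
  positivity

lemma tendsto_successProbAt [IsProbabilityMeasure P] (hlam : 0 < lam) (hσ : 0 < σ)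
    (hp : 0 < p) (hp1 : p ≤ 1) {d α θ : ℝ} (q : ℝ) {q' : ℝ} (hd : 0 < d) (hα : 2 < α) (hθ : 0 < θ)
    (hq' : 0 ≤ q') (hq1' : q' ≤ 1) {A : Set Plane} (hA : MeasurableSet A) (hA0 : volume A ≠ 0)
    (hA' : volume A < ∞) :
    Tendsto (N.successProbAt A d α θ q q') atTop
      (𝓝 (Real.exp (-(min q' p * lam / lamMax d α θ)))) := by
  have hmax := lamMax_pos hd hα hθ
  have hmin : 0 ≤ min q' p := le_min hq' hp.le
  have h1 : Tendsto (fun t => ENNReal.ofReal lam *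
      (N.transmitProb q' t * ENNReal.ofReal (1 / lamMax d α θ))) atTop
      (𝓝 (ENNReal.ofReal lam * (ENNReal.ofReal (min q' p) * ENNReal.ofReal (1 / lamMax d α θ)))) :=
    ENNReal.Tendsto.const_mul (ENNReal.Tendsto.mul_const (N.tendsto_transmitProb hp hp1 hq' hq1')
      (Or.inr ENNReal.ofReal_ne_top)) (Or.inr ENNReal.ofReal_ne_top)
  have h2 := (ENNReal.tendsto_toReal (negExp_ne_top _)).comp ((continuous_negExp.tendsto _).comp h1)
  rw [← ENNReal.ofReal_mul hmin, ← ENNReal.ofReal_mul hlam.le, negExp_ofReal (by positivity),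
    ENNReal.toReal_ofReal (Real.exp_pos _).le] at h2
  rw [show min q' p * lam / lamMax d α θ = lam * (min q' p * (1 / lamMax d α θ)) by ring]
  exact h2.congr fun t =>
    (N.successProbAt_eq hlam hσ hp.le hp1 q hd hα hθ hq' hq1' hA hA0 hA' t).symm

lemma throughput_eq [IsProbabilityMeasure P] (hlam : 0 < lam) (hσ : 0 < σ)
    (hp : 0 < p) (hp1 : p ≤ 1) {d α θ : ℝ} (R : ℝ) {q q' : ℝ} (hd : 0 < d) (hα : 2 < α)
    (hθ : 0 < θ) (hq : 0 ≤ q) (hq1 : q ≤ 1) (hq' : 0 ≤ q') (hq1' : q' ≤ 1) {A : Set Plane}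
    (hA : MeasurableSet A) (hA0 : volume A ≠ 0) (hA' : volume A < ∞) :
    N.throughput A d α θ R q q' =
      min q p * Real.exp (-(min q' p * lam / lamMax d α θ)) * R := by
  rw [throughput, energyProb, successProb,
    (N.tendsto_energyProbAt hlam hp hp1 hq hq1 hA hA0 hA').limUnder_eq,
    (N.tendsto_successProbAt hlam hσ hp hp1 q hd hα hθ hq' hq1' hA hA0 hA').limUnder_eq]
  congr 2
  split_ifs with hqp
  · rw [min_eq_left hqp, one_mul]
  · have := not_le.1 hqp
    rw [min_eq_right this.le, div_mul_cancel₀ _ (hp.trans this).ne']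

end HarvestingNetwork

theorem theorem3 {Ω : Type*} [MeasurableSpace Ω] (P : Measure Ω) [IsProbabilityMeasure P]
    (lam p σ d α θ R : ℝ) (hlam : 0 < lam) (hp : 0 < p) (hp1 : p ≤ 1) (hσ : 0 < σ) (hd : 0 < d)
    (hα : 2 < α) (hθ : 0 < θ) (hR : 0 < R) (N : HarvestingNetwork P lam p σ)
    (A : Set Plane) (hA : MeasurableSet A) (hA0 : volume A ≠ 0) (hAtop : volume A ≠ ∞) :
    -- the steady-state quantities in the throughput exist
    (∀ q ∈ Set.Icc (0 : ℝ) 1,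
      Tendsto (N.energyProbAt A q) atTop (𝓝 (N.energyProb A q))) ∧
    (∀ q ∈ Set.Icc (0 : ℝ) 1, ∀ q' ∈ Set.Icc (0 : ℝ) 1,
      Tendsto (N.successProbAt A d α θ q q') atTop (𝓝 (N.successProb A d α θ q q'))) ∧
    -- every `qs` between `p` and `1` is a symmetric Nash equilibrium
    (∀ qs : ℝ, p ≤ qs → qs ≤ 1 → N.IsSNE A d α θ R qs) ∧
    -- throughput and transmission capacity at any symmetric Nash equilibrium
    (∀ qs : ℝ, N.IsSNE A d α θ R qs →
      N.throughput A d α θ R qs qs = p * Real.exp (-(p * lam / lamMax d α θ)) * R ∧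
      N.capacity A d α θ R qs = lam * p * Real.exp (-(p * lam / lamMax d α θ)) * R) := by
  have hA' : volume A < ∞ := hAtop.lt_top
  have hth : ∀ q ∈ Set.Icc (0 : ℝ) 1, ∀ q' ∈ Set.Icc (0 : ℝ) 1, N.throughput A d α θ R q q' =
      min q p * Real.exp (-(min q' p * lam / lamMax d α θ)) * R := fun q hq q' hq' =>
    N.throughput_eq hlam hσ hp hp1 R hd hα hθ hq.1 hq.2 hq'.1 hq'.2 hA hA0 hA'
  refine ⟨fun q hq => ?_, fun q hq q' hq' => ?_, fun qs hqs hqs1 => ?_, fun qs hqs => ?_⟩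
  · have h := N.tendsto_energyProbAt hlam hp hp1 hq.1 hq.2 hA hA0 hA'
    rw [HarvestingNetwork.energyProb, h.limUnder_eq]
    exact h
  · have h := N.tendsto_successProbAt hlam hσ hp hp1 q hd hα hθ hq'.1 hq'.2 hA hA0 hA'
    rw [HarvestingNetwork.successProb, h.limUnder_eq]
    exact h
  · have hmem : qs ∈ Set.Icc (0 : ℝ) 1 := ⟨hp.le.trans hqs, hqs1⟩
    refine ⟨hmem, fun q hq => ?_⟩
    rw [hth q hq qs hmem, hth qs hmem qs hmem, min_eq_right hqs]
    gcongr
    exact min_le_right _ _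
  · obtain ⟨hmem, hmax⟩ := hqs
    -- The deviation to `p` already attains the largest possible own factor; that it does not pay
    -- forces `min qs p = p`.
    have hpmem : p ∈ Set.Icc (0 : ℝ) 1 := ⟨hp.le, hp1⟩
    have h := hmax p hpmem
    rw [hth p hpmem qs hmem, hth qs hmem qs hmem, min_self] at h
    have hle : p ≤ min qs p :=
      le_of_mul_le_mul_right (le_of_mul_le_mul_right h hR) (Real.exp_pos _)
    have hmin : min qs p = p := le_antisymm (min_le_right _ _) hle
    rw [HarvestingNetwork.capacity, hth qs hmem qs hmem, hmin]
    exact ⟨rfl, by ring⟩
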